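/- Let $Z,U$ be Banach spaces, $0<\eta<1$, $m\ge 0$ an integer and $0=p_0<t_1<p_1<t_2<\dots<p_m<t_{m+1}=p_{m+1}=a$. Let $A:D(A)\subseteq Z\to Z$ be densely defined and generate a $C_0$-semigroup $T(t)$, $t\ge 0$, on $Z$, put $M=\sup_{t\in[0,a]}\|T(t)\|$, let $B:L^q([0,a];U)\to L^q([0,a];Z)$ be linear, $z_0\in Z$, $h:[0,a]\times Z\to Z$ with $h(\cdot,x)$ strongly measurable for each $x\in Z$, and $\psi_r:[t_r,p_r]\times Z\to Z$ for $r=1,\dots,m$. Consider the non-instantaneous impulsive system $$ {}_0D_t^{\eta}z(t)=Az(t)+Bu(t)+h(t,z(t)),\quad t\in\bigcup_{r=0}^m(p_r,t_{r+1}], $$ $$ z(t)=\psi_r(t,z(t_r^-)),\quad t\in(t_r,p_r],\qquad {}_{p_r}I_t^{1-\eta}z(t)|_{t=p_r}=\psi_r(p_r,z(t_r^-)),\quad r=1,\dots,m, $$ $$ {}_0I_t^{1-\eta}z(t)|_{t=0}=z_0, $$ with the Riemann–Liouville derivative ${}_0D^\eta_t$ and integrals ${}_{p_r}I_t^{1-\eta}$.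 Let $PC_{1-\eta}([0,a];Z)$ be the space of functions $z$ that are continuous on each $(p_r,t_{r+1})$ ($0\le r\le m$) and each $(t_r,p_r)$ ($1\le r\le m$), are left-continuous at $t_r$ and $p_r$ ($1\le r\le m$), and satisfy $\sup_{t\in(p_r,p_{r+1}]}(t-p_r)^{1-\eta}\|z(t)\|<\infty$ for $0\le r\le m$; functions that agree on $(0,a]$ are identified. For $\theta>0$ put $$\varpi_\eta(\theta)=\frac1\pi\sum_{n=1}^\infty(-1)^{n-1}\theta^{-n\eta-1}\frac{\Gamma(n\eta+1)}{n!}\sin(n\pi\eta),\qquad \xi_\eta(\theta)=\frac1\eta\,\theta^{-1-1/\eta}\,\varpi_\eta(\theta^{-1/\eta}),$$ and let $T_\eta(t)x=\eta\int_0^\infty\theta\,\xi_\eta(\theta)\,T(t^\eta\theta)x\,d\theta$ for $x \in Z$, $t\ge 0$. A mild solution of the system is a function $z\in PC_{1-\eta}([0,a];Z)$ such that, for $t\in(p_r,t_{r+1}]$, $r=0,\dots,m$, $$z(t)=(t-p_r)^{\eta-1}T_\eta(t-p_r)\psi_r(p_r,z(t_r^-))+\int_{p_r}^t(t-s)^{\eta-1}T_\eta(t-s)\big[Bu(s)+h(s,z(s))+\phi_r(s,z(s))\big]ds,$$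 and $z(t)=\psi_r(t,z(t_r^-))$ for $t\in(t_r,p_r]$, $r=1,\dots,m$. Here, for $r=0$, $\psi_0(p_0,z(t_0^-))$ stands for $z_0$ and $\phi_0=0$, and for $r\ge1$ $$\phi_r(s,z(s))=\frac{\eta}{\Gamma(1-\eta)}\sum_{k=0}^{r-1}\left(\int_{p_k}^{t_{k+1}}\frac{z(\sigma)}{(s-\sigma)^{1+\eta}}\,d\sigma+\int_{t_{k+1}}^{p_{k+1}}\frac{\psi_{k+1}(\sigma,z(t_{k+1}^-))}{(s-\sigma)^{1+\eta}}\,d\sigma\right).$$ Assume: (H0) $q\in\left(\frac1\eta,\frac1{1-\eta}\right)$. (H1) There is $\kappa>0$ with $\|h(t,z)-h(t,y)\|\le\kappa\|z-y\|$ for all $t\in[0,a]$ and $z,y\in Z$. (H2) There are a nonnegative $\varsigma\in L^q([0,a])$ and $d>0$ such that, for $r=0,\dots,m$ and almost every $t\in(p_r,p_{r+1}]$, $\|h(t,z)\|\le\varsigma(t)+d(t-p_r)^{1-\eta}\|z\|$ for all $z\in Z$. (H3) For $r=1,\dots,m$, $\psi_r$ is continuous and there is $b_r\in(0,1]$ with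 $\|\psi_r(t,z)-\psi_r(t,y)\|\le b_r\|z-y\|$ for all $t\in[t_r,p_r]$ and $z,y\in Z$. (H4) $\nu<1$, where $$\nu=\max_{r=1,\dots,m}\Bigg[\frac{Mb_r}{\Gamma(\eta)(t_r-p_{r-1})^{1-\eta}}+\frac{M\kappa\Gamma(\eta)}{\Gamma(2\eta)}(t_{r+1}-p_r)^\eta+\frac{M}{\Gamma(1+\eta)\Gamma(1-\eta)}\Bigg(\sum_{k=0}^{r-1}\Big(\frac{t_{k+1}-p_k}{p_r-t_{k+1}}\Big)^\eta+\sum_{k=0}^{r-2}\frac{b_{k+1}(t_{r+1}-p_r)}{(t_{k+1}-p_k)^{1-\eta}(p_r-p_{k+1})^\eta}\Bigg)+\frac{Mb_r(t_{r+1}-p_r)^{1-\eta}}{(t_r-p_{r-1})^{1-\eta}}\Bigg]$$ (no condition if $m=0$). Then for every control $u\in L^q([0,a];U)$ the system has a unique mild solution in $PC_{1-\eta}([0,a];Z)$. -/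

import Mathlib

open MeasureTheory Set Filter Topology

noncomputable section

namespace RLImpulse

/-- `T`, restricted to `[0, ∞)`, is a strongly continuous (`C₀`) semigroup of bounded operators.
The values of `T` at negative times play no role. -/
structure IsC0Semigroup {Z : Type*} [NormedAddCommGroup Z] [NormedSpace ℝ Z]
    (T : ℝ → Z →L[ℝ] Z) : Prop where
  map_zero : T 0 = ContinuousLinearMap.id ℝ Z
  map_add : ∀ s t : ℝ, 0 ≤ s → 0 ≤ t → T (s + t) = (T s).comp (T t)
  tendsto_zero : ∀ x : Z, Tendsto (fun s => T s x) (𝓝[>] 0) (𝓝 x)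

/-- `A` is the infinitesimal generator of `T`: the domain of `A` consists of exactly those `x`
for which `(T s x - x) / s` converges as `s → 0+`, and `A x` is that limit. -/
def IsGenerator {Z : Type*} [NormedAddCommGroup Z] [NormedSpace ℝ Z]
    (A : Z →ₗ.[ℝ] Z) (T : ℝ → Z →L[ℝ] Z) : Prop :=
  ∀ x y : Z, (x, y) ∈ A.graph ↔
    Tendsto (fun s : ℝ => s⁻¹ • (T s x - x)) (𝓝[>] 0) (𝓝 y)

/-- `M = sup_{t ∈ [0, a]} ‖T t‖`. -/
def semigroupBound {Z : Type*} [NormedAddCommGroup Z] [NormedSpace ℝ Z]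
    (T : ℝ → Z →L[ℝ] Z) (a : ℝ) : ℝ :=
  sSup ((fun t => ‖T t‖) '' Icc 0 a)

/-- `0 = p₀ < t₁ < p₁ < t₂ < ... < pₘ < tₘ₊₁ = pₘ₊₁ = a`. Only `p₀, ..., pₘ₊₁` and
`t₁, ..., tₘ₊₁` are used. -/
structure IsImpulseTimes (m : ℕ) (a : ℝ) (p t : ℕ → ℝ) : Prop where
  p_zero : p 0 = 0
  p_lt_t : ∀ r, r ≤ m → p r < t (r + 1)
  t_lt_p : ∀ r, 1 ≤ r → r ≤ m → t r < p r
  t_last : t (m + 1) = a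
  p_last : p (m + 1) = a

/-- Membership in the weighted space `PC_{1-η}([0, a]; Z)`. The value at the time `0` is not
constrained (and is not seen by the weighted norm of the space). -/
structure MemPC {Z : Type*} [NormedAddCommGroup Z] (η : ℝ) (m : ℕ) (p t : ℕ → ℝ)
    (z : ℝ → Z) : Prop where
  continuousOn_left : ∀ r, r ≤ m → ContinuousOn z (Ioo (p r) (t (r + 1)))
  continuousOn_right : ∀ r, 1 ≤ r → r ≤ m → ContinuousOn z (Ioo (t r) (p r))
  tendsto_p : ∀ r, 1 ≤ r → r ≤ m → Tendsto z (𝓝[<] (p r)) (𝓝 (z (p r)))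
  tendsto_t : ∀ r, 1 ≤ r → r ≤ m → Tendsto z (𝓝[<] (t r)) (𝓝 (z (t r)))
  bddAbove : ∀ r, r ≤ m →
    BddAbove ((fun s => (s - p r) ^ (1 - η) * ‖z s‖) '' Ioc (p r) (p (r + 1)))

/-- The one-sided stable density `ϖ_η(θ) =
(1/π) ∑_{n ≥ 1} (-1)^(n-1) θ^(-nη-1) (Γ(nη+1)/n!) sin(nπη)`; the index is `n + 1` below. -/
def stableDensity (η θ : ℝ) : ℝ :=
  (1 / Real.pi) * ∑' n : ℕ, (-1 : ℝ) ^ n * θ ^ (-((n + 1 : ℕ) : ℝ) * η - 1) *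
    (Real.Gamma (((n + 1 : ℕ) : ℝ) * η + 1) / ((n + 1).factorial : ℝ)) *
    Real.sin (((n + 1 : ℕ) : ℝ) * Real.pi * η)

/-- `ξ_η(θ) = (1/η) θ^(-1-1/η) ϖ_η(θ^(-1/η))`. -/
def xi (η θ : ℝ) : ℝ :=
  (1 / η) * θ ^ (-1 - 1 / η) * stableDensity η (θ ^ (-(1 / η)))

/-- `T_η(t) x = η ∫_0^∞ θ ξ_η(θ) T(t^η θ) x dθ`. -/
def fracOp {Z : Type*} [NormedAddCommGroup Z] [NormedSpace ℝ Z]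
    (η : ℝ) (T : ℝ → Z →L[ℝ] Z) (t : ℝ) (x : Z) : Z :=
  η • ∫ θ in Ioi (0 : ℝ), (θ * xi η θ) • T (t ^ η * θ) x

/-- The memory term `φ_r(s, z(s))`, which depends on the history of `z` up to the time `p r`.
For `r = 0` the sum is empty and `φ_0 = 0`. The left limit `z(t_{k+1}^-)` is `z (t (k + 1))`
for every `z` in the weighted space. -/
def memoryTerm {Z : Type*} [NormedAddCommGroup Z] [NormedSpace ℝ Z]
    (η : ℝ) (p t : ℕ → ℝ) (ψ : ℕ → ℝ → Z → Z) (z : ℝ → Z) (r : ℕ) (s : ℝ) : Z :=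
  (η / Real.Gamma (1 - η)) • ∑ k ∈ Finset.range r,
    ((∫ σ in (p k)..(t (k + 1)), (1 / (s - σ) ^ (1 + η)) • z σ) +
      ∫ σ in (t (k + 1))..(p (k + 1)),
        (1 / (s - σ) ^ (1 + η)) • ψ (k + 1) σ (z (t (k + 1))))

/-- The datum at the time `p r`: `ψ_0 = z₀`, and `ψ_r(p_r, z(t_r^-))` for `r ≥ 1`. -/
def startValue {Z : Type*} (p t : ℕ → ℝ) (ψ : ℕ → ℝ → Z → Z) (z₀ : Z) (z : ℝ → Z)
    (r : ℕ) : Z :=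
  if r = 0 then z₀ else ψ r (p r) (z (t r))

/-- `z` is a mild solution, in the weighted space, of the impulsive system with nonlinearity `h`,
impulses `ψ`, initial datum `z₀` and forcing term `f` (the function `s ↦ (B u)(s)`). -/
structure IsMildSolution {Z : Type*} [NormedAddCommGroup Z] [NormedSpace ℝ Z]
    (η : ℝ) (m : ℕ) (p t : ℕ → ℝ) (T : ℝ → Z →L[ℝ] Z) (f : ℝ → Z)
    (h : ℝ → Z → Z) (ψ : ℕ → ℝ → Z → Z) (z₀ : Z) (z : ℝ → Z) : Prop where
  memPC : MemPC η m p t z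
  eq_evolution : ∀ r, r ≤ m → ∀ τ ∈ Ioc (p r) (t (r + 1)),
    z τ = (τ - p r) ^ (η - 1) • fracOp η T (τ - p r) (startValue p t ψ z₀ z r) +
      ∫ s in (p r)..τ, (τ - s) ^ (η - 1) •
        fracOp η T (τ - s) (f s + h s (z s) + memoryTerm η p t ψ z r s)
  eq_impulse : ∀ r, 1 ≤ r → r ≤ m → ∀ τ ∈ Ioc (t r) (p r), z τ = ψ r τ (z (t r))

/-- The expression under the maximum in the definition of `ν`, for an index `r ≥ 1`. -/
def nuTerm (η M κ : ℝ) (p t b : ℕ → ℝ) (r : ℕ) : ℝ :=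
  M * b r / (Real.Gamma η * (t r - p (r - 1)) ^ (1 - η)) +
    M * κ * Real.Gamma η / Real.Gamma (2 * η) * (t (r + 1) - p r) ^ η +
    M / (Real.Gamma (1 + η) * Real.Gamma (1 - η)) *
      ((∑ k ∈ Finset.range r, ((t (k + 1) - p k) / (p r - t (k + 1))) ^ η) +
        ∑ k ∈ Finset.range (r - 1), b (k + 1) * (t (r + 1) - p r) /
          ((t (k + 1) - p k) ^ (1 - η) * (p r - p (k + 1)) ^ η)) +
    M * b r * (t (r + 1) - p r) ^ (1 - η) / (t r - p (r - 1)) ^ (1 - η)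

/-- `ν`, the maximum over `r = 1, ..., m` (it is `0`, hence no restriction, if `m = 0`). -/
def nu (η M κ : ℝ) (m : ℕ) (p t b : ℕ → ℝ) : ℝ :=
  ⨆ i : Fin m, nuTerm η M κ p t b (i.val + 1)

end RLImpulse

end

/-!
Between two impulses the mild solution solves a Volterra equation with Lipschitz nonlinearity and
weakly singular kernel `(τ - s) ^ (η - 1) T_η(τ - s)`, whose forcing term and initial datum involve
only the values of the solution on the earlier intervals. The solution is therefore built, and shown to
be unique, one interval `(p r, t (r + 1)]` after the other; on `(t r, p r]` it is prescribed by the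
impulse.

*The operators `T_η(t)`.* The semigroup may grow exponentially, so that the integral defining
`T_η(t)` converges only because `ξ_η` decays faster than every exponential (`exists_abs_xi_le`).
The power series of `ξ_η` is summed to an integral over the two sides of the cut of the slit plane
(`xi_eq_integral`), and Cauchy's theorem deforms that contour into an arc of an arbitrary radius `R`
followed by two rays (`xi_eq_hankel`); on the new contour the integrand is `O(exp (-c R ^ η θ))`.
In consequence `T_η` is a bounded, strongly continuous family of operators on `[0, a]`
(`exists_fracOp_eq_clm`).

*The Volterra equation.* Forcing terms are admitted that are dominated by an `L^q` function plus a
multiple of `(s - p) ^ (-γ)` with `γ < 1` (`SingularLp`): this covers the control term, the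
nonlinearity along a function of the weighted space (`γ = 1 - η`) and the memory term (`γ = η`).
Since `q > 1 / η`, Hölder's inequality and a Beta integral bound show that the convolution with the
kernel is continuous and lies in the weighted space. With the weight
`exp (-λ (s - p)) (s - p) ^ (1 - η)` and `λ` large the Volterra map is a contraction
(`VolterraData.exists_contraction`) for every Lipschitz constant of the nonlinearity and every
length of the interval.

*The memory term.* Up to the time `p r` the history is integrable, and bounded next to `p r`, so
that the integral of `(s - σ) ^ (-1 - η)` against it is `O((s - p r) ^ (-η))`
(`singularLp_memoryTerm`).
-/

namespace RLImpulse

/-! ### The Wright function as a contour integral -/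

/-- The integrand of the Hankel contour integral of the Wright function, in the logarithmic
coordinate `w = log σ`; it is entire in `w`. -/
noncomputable def wrightKernel (η θ : ℝ) (w : ℂ) : ℂ :=
  Complex.exp (Complex.exp w - θ * Complex.exp (η * w) + η * w)

theorem differentiable_wrightKernel (η θ : ℝ) : Differentiable ℂ (wrightKernel η θ) := by
  unfold wrightKernel; fun_prop

theorem norm_wrightKernel (η θ x y : ℝ) :
    ‖wrightKernel η θ (x + y * Complex.I)‖ =
      Real.exp (Real.exp x * Real.cos y - θ * (Real.exp (η * x) * Real.cos (η * y)) + η * x) := by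
  have h1 : Complex.exp (x + y * Complex.I) =
      Real.exp x * (Complex.cos y + Complex.sin y * Complex.I) := by
    rw [Complex.exp_add, Complex.exp_mul_I, Complex.ofReal_exp]
  have h2 : Complex.exp (η * (x + y * Complex.I)) =
      Real.exp (η * x) *
        (Complex.cos ((η * y : ℝ) : ℂ) + Complex.sin ((η * y : ℝ) : ℂ) * Complex.I) := by
    rw [← Complex.exp_mul_I, Complex.ofReal_exp, ← Complex.exp_add]
    congr 1; push_cast; ring
  rw [wrightKernel, Complex.norm_exp, h1, h2]
  congr 1
  simp [← Complex.ofReal_cos, ← Complex.ofReal_sin, -Complex.ofReal_mul, -Complex.ofReal_exp]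

theorem integrable_exp_neg_mul_exp {c μ : ℝ} (hc : 0 < c) (hμ : 0 < μ) :
    Integrable (fun x : ℝ => Real.exp (-c * Real.exp x + μ * x)) := by
  have h := integrableOn_image_iff_integrableOn_abs_deriv_smul
    (MeasurableSet.univ (α := ℝ)) (fun x _ => (Real.hasDerivAt_exp x).hasDerivWithinAt)
      (fun x _ y _ hxy => Real.exp_injective hxy)
      (fun s : ℝ => s ^ (μ - 1) * Real.exp (-c * s ^ (1 : ℝ)))
  rw [image_univ, Real.range_exp, integrableOn_univ] at h
  refine (h.1 (integrableOn_rpow_mul_exp_neg_mul_rpow (by linarith) one_pos hc)).congr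
    (Eventually.of_forall fun x => ?_)
  simp only [Real.rpow_one, smul_eq_mul, abs_of_pos (Real.exp_pos x)]
  rw [← Real.exp_mul, ← Real.exp_add, ← Real.exp_add]
  congr 1; ring

theorem integral_exp_neg_exp {μ : ℝ} (hμ : 0 < μ) :
    ∫ x : ℝ, Real.exp (-Real.exp x + μ * x) = Real.Gamma μ := by
  have h := integral_image_eq_integral_abs_deriv_smul
    (MeasurableSet.univ (α := ℝ)) (fun x _ => (Real.hasDerivAt_exp x).hasDerivWithinAt)
      (fun x _ y _ hxy => Real.exp_injective hxy)
      (fun s : ℝ => Real.exp (-s) * s ^ (μ - 1))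
  rw [image_univ, Real.range_exp] at h
  rw [Real.Gamma_eq_integral hμ, h, Measure.restrict_univ]
  congr 1; ext x
  simp only [smul_eq_mul, abs_of_pos (Real.exp_pos x)]
  rw [← Real.exp_mul, ← Real.exp_add, ← Real.exp_add]
  congr 1; ring

/-- Since `η < 1`, the growing term `θ e^{ηx}` is absorbed by a fraction of `c e^x`. -/
theorem exists_mul_exp_le {η c θ : ℝ} (hη0 : 0 < η) (hη1 : η < 1) (hc : 0 < c) (hθ : 0 ≤ θ) :
    ∃ K : ℝ, ∀ x : ℝ, θ * Real.exp (η * x) ≤ c / 2 * Real.exp x + K := by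
  set y := Real.log (2 * θ / c + 1) / (1 - η) with hy
  refine ⟨θ * Real.exp (η * y), fun x => ?_⟩
  have hpos : 0 < 2 * θ / c + 1 := by positivity
  rcases le_total x y with hxy | hxy
  · have : Real.exp (η * x) ≤ Real.exp (η * y) := by gcongr
    nlinarith [Real.exp_pos x, mul_le_mul_of_nonneg_left this hθ]
  · have h1 : Real.log (2 * θ / c + 1) ≤ (1 - η) * x := by
      rw [hy, div_le_iff₀ (by linarith)] at hxy; linarith
    have h2 : 2 * θ / c + 1 ≤ Real.exp ((1 - η) * x) := (Real.log_le_iff_le_exp hpos).1 h1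
    have h3 : Real.exp x = Real.exp ((1 - η) * x) * Real.exp (η * x) := by
      rw [← Real.exp_add]; congr 1; ring
    have h4 : θ = c / 2 * (2 * θ / c) := by field_simp
    have h5 : θ * Real.exp (η * x) ≤ c / 2 * Real.exp x := by
      rw [h3, ← mul_assoc]
      apply mul_le_mul_of_nonneg_right _ (Real.exp_pos _).le
      rw [h4]; gcongr; field_simp at h2 ⊢; linarith
    have : 0 ≤ θ * Real.exp (η * y) := by positivity
    linarith

theorem integrable_wright_majorant {η c θ : ℝ} (hη0 : 0 < η) (hη1 : η < 1) (hc : 0 < c)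
    (hθ : 0 ≤ θ) :
    Integrable (fun x : ℝ => Real.exp (-c * Real.exp x + θ * Real.exp (η * x) + η * x)) := by
  obtain ⟨K, hK⟩ := exists_mul_exp_le hη0 hη1 hc hθ
  refine ((integrable_exp_neg_mul_exp (half_pos hc) hη0).const_mul (Real.exp K)).mono'
    (by fun_prop) (Eventually.of_forall fun x => ?_)
  rw [Real.norm_eq_abs, abs_of_pos (Real.exp_pos _), ← Real.exp_add]
  exact Real.exp_le_exp.2 (by linarith [hK x])

theorem tendsto_wright_majorant_atTop {η c θ : ℝ} (hη0 : 0 < η) (hη1 : η < 1) (hc : 0 < c)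
    (hθ : 0 ≤ θ) :
    Tendsto (fun x : ℝ => Real.exp (-c * Real.exp x + θ * Real.exp (η * x) + η * x)) atTop
      (𝓝 0) := by
  obtain ⟨K, hK⟩ := exists_mul_exp_le hη0 hη1 hc (by positivity : 0 ≤ θ + 1)
  have hlim : Tendsto (fun x : ℝ => K + -(c / 2) * Real.exp x) atTop atBot :=
    tendsto_atBot_add_const_left _ _
      (Real.tendsto_exp_atTop.const_mul_atTop_of_neg (by linarith))
  refine Real.tendsto_exp_atBot.comp (tendsto_atBot_mono (fun x => ?_) hlim)
  have h1 := hK x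
  have h2 := Real.add_one_le_exp (η * x)
  nlinarith

theorem tendsto_wright_majorant_atBot {η c θ : ℝ} (hη0 : 0 < η) :
    Tendsto (fun x : ℝ => Real.exp (c * Real.exp x + θ * Real.exp (η * x) + η * x)) atBot
      (𝓝 0) := by
  have h1 : Tendsto (fun x : ℝ => η * x) atBot atBot := tendsto_id.const_mul_atBot hη0
  refine Real.tendsto_exp_atBot.comp (Tendsto.add_atBot ((Real.tendsto_exp_atBot.const_mul c).add
    ((Real.tendsto_exp_atBot.comp h1).const_mul θ)) h1)

theorem hasSum_of_forall_eq {E : Type*} [AddCommMonoid E] [TopologicalSpace E] {f g : ℕ → E}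
    {v : E} (hfg : ∀ n, f n = g n) (hg : HasSum g v) : HasSum f v := by
  rwa [funext hfg]

/-- The power series of `ξ_η`. -/
theorem xi_eq_tsum {η θ : ℝ} (hη : 0 < η) (hθ : 0 < θ) :
    xi η θ = (1 / Real.pi) * ∑' n : ℕ, (-θ) ^ n / n.factorial *
      (Real.Gamma (((n + 1 : ℕ) : ℝ) * η) * Real.sin (((n + 1 : ℕ) : ℝ) * Real.pi * η)) := by
  rw [xi, stableDensity, ← mul_assoc, mul_comm _ (1 / Real.pi), mul_assoc, ← tsum_mul_left]
  congr 2; ext n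
  have h1 : (θ ^ (-(1 / η))) ^ (-((n + 1 : ℕ) : ℝ) * η - 1) =
      θ ^ n * θ ^ (1 + 1 / η) := by
    rw [← Real.rpow_natCast θ n, ← Real.rpow_add hθ, ← Real.rpow_mul hθ.le]
    congr 1; push_cast; field_simp; ring
  have h2 : θ ^ (-1 - 1 / η) * θ ^ (1 + 1 / η) = 1 := by
    rw [← Real.rpow_add hθ]; simp
  have h3 : Real.Gamma (((n + 1 : ℕ) : ℝ) * η + 1) =
      ((n + 1 : ℕ) : ℝ) * η * Real.Gamma (((n + 1 : ℕ) : ℝ) * η) :=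
    Real.Gamma_add_one (by positivity)
  have h4 : ((n + 1).factorial : ℝ) = ((n + 1 : ℕ) : ℝ) * n.factorial := by
    rw [Nat.factorial_succ]; push_cast; ring
  have h5 : (-θ) ^ n = (-1) ^ n * θ ^ n := by rw [← mul_pow]; simp
  rw [h1, h3, h4, h5]
  have h6 : ((n + 1 : ℕ) : ℝ) ≠ 0 := by positivity
  generalize Real.sin (((n + 1 : ℕ) : ℝ) * Real.pi * η) = S
  generalize Real.Gamma (((n + 1 : ℕ) : ℝ) * η) = G
  generalize ((n + 1 : ℕ) : ℝ) = N at *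
  generalize θ ^ (-1 - 1 / η) = u at *
  generalize θ ^ (1 + 1 / η) = v at *
  field_simp
  linear_combination G * S * h2

/-- Integrating the exponential series term by term represents `ξ_η` as the integral of the
jump of the Hankel integrand across the cut `Im w = ±π`. -/
theorem xi_eq_integral {η θ : ℝ} (hη0 : 0 < η) (hη1 : η < 1) (hθ : 0 < θ) :
    xi η θ = (1 / Real.pi) * ∫ x : ℝ, (wrightKernel η θ (x + Real.pi * Complex.I)).im := by
  rw [xi_eq_tsum hη0 hθ]
  congr 1
  have hsum : ∀ x : ℝ, HasSum (fun n : ℕ => θ ^ n / n.factorial *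
      Real.exp (-Real.exp x + ((n + 1 : ℕ) : ℝ) * η * x))
      (Real.exp (-1 * Real.exp x + θ * Real.exp (η * x) + η * x)) := by
    intro x
    have h := (NormedSpace.expSeries_div_hasSum_exp (θ * Real.exp (η * x))).mul_left
      (Real.exp (-Real.exp x + η * x))
    rw [← Real.exp_eq_exp_ℝ, ← Real.exp_add] at h
    rw [show -1 * Real.exp x + θ * Real.exp (η * x) + η * x =
      -Real.exp x + η * x + θ * Real.exp (η * x) by ring]
    refine hasSum_of_forall_eq (fun n => ?_) h
    rw [mul_pow, ← Real.exp_nat_mul]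
    have : Real.exp (-Real.exp x + ((n + 1 : ℕ) : ℝ) * η * x) =
        Real.exp (-Real.exp x + η * x) * Real.exp (n * (η * x)) := by
      rw [← Real.exp_add]; congr 1; push_cast; ring
    rw [this]; ring
  have key := hasSum_integral_of_dominated_convergence (μ := (volume : Measure ℝ))
    (F := fun (n : ℕ) (x : ℝ) => (-θ) ^ n / n.factorial *
      (Real.exp (-Real.exp x + ((n + 1 : ℕ) : ℝ) * η * x) *
        Real.sin (((n + 1 : ℕ) : ℝ) * Real.pi * η)))
    (f := fun x : ℝ => (wrightKernel η θ (x + Real.pi * Complex.I)).im)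
    (fun n x => θ ^ n / n.factorial * Real.exp (-Real.exp x + ((n + 1 : ℕ) : ℝ) * η * x))
    (fun n => by fun_prop)
    (fun n => Eventually.of_forall fun x => by
      rw [norm_mul, norm_div, norm_pow, norm_neg, norm_mul, Real.norm_of_nonneg hθ.le,
        Real.norm_of_nonneg (Real.exp_pos _).le, Real.norm_natCast]
      gcongr
      exact mul_le_of_le_one_right (Real.exp_pos _).le (Real.abs_sin_le_one _))
    (Eventually.of_forall fun x => (hsum x).summable)
    (by
      simp_rw [fun x => (hsum x).tsum_eq]
      exact integrable_wright_majorant hη0 hη1 one_pos hθ.le)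
    (Eventually.of_forall fun x => by
      have hexp : Complex.exp (x + Real.pi * Complex.I) = -Real.exp x := by
        rw [Complex.exp_add, Complex.exp_pi_mul_I, Complex.ofReal_exp]; ring
      have h := (NormedSpace.expSeries_div_hasSum_exp
        (-θ * Complex.exp (η * (x + Real.pi * Complex.I)))).mul_left
        (Complex.exp (-Real.exp x + η * (x + Real.pi * Complex.I)))
      rw [← Complex.exp_eq_exp_ℂ, ← Complex.exp_add] at h
      have h' := Complex.imCLM.hasSum h
      have hv : wrightKernel η θ (x + Real.pi * Complex.I) =
          Complex.exp (-Real.exp x + η * (x + Real.pi * Complex.I) +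
            -θ * Complex.exp (η * (x + Real.pi * Complex.I))) := by
        rw [wrightKernel, hexp]; congr 1; ring
      rw [hv]
      refine hasSum_of_forall_eq (fun n => ?_) h'
      have e1 : Complex.exp (-Real.exp x + η * (x + Real.pi * Complex.I)) *
          ((-θ * Complex.exp (η * (x + Real.pi * Complex.I))) ^ n / n.factorial) =
          (((-θ) ^ n / n.factorial : ℝ) : ℂ) *
            Complex.exp (((-Real.exp x + ((n + 1 : ℕ) : ℝ) * η * x : ℝ) : ℂ) +
              ((((n + 1 : ℕ) : ℝ) * Real.pi * η : ℝ) : ℂ) * Complex.I) := by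
        rw [mul_pow, ← Complex.exp_nat_mul]
        have : Complex.exp (((-Real.exp x + ((n + 1 : ℕ) : ℝ) * η * x : ℝ) : ℂ) +
              ((((n + 1 : ℕ) : ℝ) * Real.pi * η : ℝ) : ℂ) * Complex.I) =
            Complex.exp (-Real.exp x + η * (x + Real.pi * Complex.I)) *
              Complex.exp (n * (η * (x + Real.pi * Complex.I))) := by
          rw [← Complex.exp_add]; congr 1; push_cast; ring
        rw [this]; push_cast; ring
      rw [e1, Complex.imCLM_apply, Complex.im_ofReal_mul, Complex.exp_im]
      simp [-Complex.ofReal_mul, -Complex.ofReal_add, -Complex.ofReal_exp, -Nat.cast_add])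
  rw [← key.tsum_eq]
  congr 1; ext n
  rw [integral_const_mul, integral_mul_const, integral_exp_neg_exp (by positivity)]

/-! ### Superexponential decay of the Wright function -/

theorem continuous_wrightKernel_line (η θ : ℝ) :
    Continuous (fun q : ℝ × ℝ => wrightKernel η θ (q.1 + q.2 * Complex.I)) :=
  (differentiable_wrightKernel η θ).continuous.comp (by fun_prop)

/-- Cauchy's theorem for the Hankel integrand on a rectangle, imaginary part. -/
theorem integral_im_wrightKernel_rect (η θ x₀ x₁ y₀ y₁ : ℝ) :
    ∫ x in x₀..x₁, (wrightKernel η θ (x + y₁ * Complex.I)).im =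
      (∫ x in x₀..x₁, (wrightKernel η θ (x + y₀ * Complex.I)).im) +
        (∫ y in y₀..y₁, (wrightKernel η θ (x₁ + y * Complex.I)).re) -
        ∫ y in y₀..y₁, (wrightKernel η θ (x₀ + y * Complex.I)).re := by
  have h := Complex.integral_boundary_rect_eq_zero_of_differentiableOn (wrightKernel η θ)
    ⟨x₀, y₀⟩ ⟨x₁, y₁⟩ (differentiable_wrightKernel η θ).differentiableOn
  have hc := continuous_wrightKernel_line η θ
  have hx : ∀ y : ℝ, Continuous (fun x : ℝ => wrightKernel η θ (x + y * Complex.I)) :=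
    fun y => hc.comp (by fun_prop : Continuous fun x : ℝ => (x, y))
  have hy : ∀ x : ℝ, Continuous (fun y : ℝ => wrightKernel η θ (x + y * Complex.I)) :=
    fun x => hc.comp (by fun_prop : Continuous fun y : ℝ => (x, y))
  have him : ∀ y : ℝ, ∫ x in x₀..x₁, (wrightKernel η θ (x + y * Complex.I)).im =
      (∫ x in x₀..x₁, wrightKernel η θ (x + y * Complex.I)).im := fun y =>
    Complex.imCLM.intervalIntegral_comp_comm ((hx y).intervalIntegrable _ _)
  have hre : ∀ x : ℝ, ∫ y in y₀..y₁, (wrightKernel η θ (x + y * Complex.I)).re =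
      (∫ y in y₀..y₁, wrightKernel η θ (x + y * Complex.I)).re := fun x =>
    Complex.reCLM.intervalIntegral_comp_comm ((hy x).intervalIntegrable _ _)
  have h' := congrArg Complex.im h
  simp only [smul_eq_mul, Complex.sub_im, Complex.add_im, Complex.I_mul_im, Complex.zero_im] at h'
  rw [him, him, hre, hre]
  linarith

theorem norm_wrightKernel_le {η θ c x y : ℝ} (hθ : 0 ≤ θ) (hy : Real.cos y ≤ c) :
    ‖wrightKernel η θ (x + y * Complex.I)‖ ≤
      Real.exp (c * Real.exp x + θ * Real.exp (η * x) + η * x) := by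
  rw [norm_wrightKernel]
  apply Real.exp_le_exp.2
  have h1 := mul_le_mul_of_nonneg_left hy (Real.exp_pos x).le
  have h2 : -(θ * (Real.exp (η * x) * Real.cos (η * y))) ≤ θ * Real.exp (η * x) := by
    have := Real.neg_one_le_cos (η * y)
    nlinarith [mul_nonneg hθ (Real.exp_pos (η * x)).le]
  linarith

theorem tendsto_integral_re_wrightKernel {η θ c y₀ y₁ : ℝ} {l : Filter ℝ} (hθ : 0 ≤ θ)
    (hy : y₀ ≤ y₁) (hc : ∀ y ∈ Ioc y₀ y₁, Real.cos y ≤ c)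
    (hl : Tendsto (fun x : ℝ => Real.exp (c * Real.exp x + θ * Real.exp (η * x) + η * x)) l
      (𝓝 0)) :
    Tendsto (fun x : ℝ => ∫ y in y₀..y₁, (wrightKernel η θ (x + y * Complex.I)).re) l (𝓝 0) := by
  have hl' := hl.mul_const |y₁ - y₀|
  rw [zero_mul] at hl'
  refine squeeze_zero_norm (fun x => ?_) hl'
  refine intervalIntegral.norm_integral_le_of_norm_le_const fun y hy' => ?_
  rw [uIoc_of_le hy] at hy'
  exact (Complex.abs_re_le_norm _).trans (norm_wrightKernel_le hθ (hc y hy'))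

theorem integrable_im_wrightKernel {η θ y : ℝ} (hη0 : 0 < η) (hη1 : η < 1) (hθ : 0 ≤ θ)
    (hy : Real.cos y < 0) :
    Integrable (fun x : ℝ => (wrightKernel η θ (x + y * Complex.I)).im) := by
  refine (integrable_wright_majorant hη0 hη1 (neg_pos.2 hy) hθ).mono'
    (Complex.continuous_im.comp ((continuous_wrightKernel_line η θ).comp
      (by fun_prop : Continuous fun x : ℝ => (x, y)))).aestronglyMeasurable
    (Eventually.of_forall fun x => (Complex.abs_im_le_norm _).trans ?_)
  rw [neg_neg]
  exact norm_wrightKernel_le hθ le_rfl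

/-- The Hankel contour of `ξ_η`, deformed so as to consist of an arc of radius `exp X` and of the
rays at the angles `±β`. Only the upper half appears, by symmetry. -/
theorem xi_eq_hankel {η θ β : ℝ} (hη0 : 0 < η) (hη1 : η < 1) (hθ : 0 < θ)
    (hβ0 : Real.pi / 2 < β) (hβ1 : β < Real.pi) (X : ℝ) :
    xi η θ = (1 / Real.pi) * ((∫ x in Ioi X, (wrightKernel η θ (x + β * Complex.I)).im) +
      ∫ y in (0 : ℝ)..β, (wrightKernel η θ (X + y * Complex.I)).re) := by
  have hcosβ : Real.cos β < 0 := Real.cos_neg_of_pi_div_two_lt_of_lt hβ0 (by linarith)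
  have hcosπ : Real.cos Real.pi < 0 := by simp
  have hintπ := integrable_im_wrightKernel hη0 hη1 hθ.le hcosπ
  have hintβ := integrable_im_wrightKernel hη0 hη1 hθ.le hcosβ
  have hA : ∫ x in Iic X, (wrightKernel η θ (x + Real.pi * Complex.I)).im =
      ∫ y in (0 : ℝ)..Real.pi, (wrightKernel η θ (X + y * Complex.I)).re := by
    refine tendsto_nhds_unique
      (intervalIntegral_tendsto_integral_Iic X hintπ.integrableOn tendsto_id) ?_
    have h0 : ∀ x : ℝ, (wrightKernel η θ (x + (0 : ℝ) * Complex.I)).im = 0 := by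
      intro x
      have : wrightKernel η θ (x + (0 : ℝ) * Complex.I) =
          ((Real.exp (Real.exp x - θ * Real.exp (η * x) + η * x) : ℝ) : ℂ) := by
        simp [wrightKernel]
      rw [this, Complex.ofReal_im]
    have hlim := tendsto_integral_re_wrightKernel (η := η) (θ := θ) (c := 1) (y₀ := 0)
      (y₁ := Real.pi) hθ.le Real.pi_pos.le (fun y _ => Real.cos_le_one y)
      (tendsto_wright_majorant_atBot hη0)
    have := (tendsto_const_nhds
      (x := ∫ y in (0 : ℝ)..Real.pi, (wrightKernel η θ (X + y * Complex.I)).re)).sub hlim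
    rw [sub_zero] at this
    refine this.congr fun x => ?_
    rw [id, integral_im_wrightKernel_rect η θ x X 0 Real.pi]
    simp_rw [h0]
    simp
  have hB : ∫ x in Ioi X, (wrightKernel η θ (x + Real.pi * Complex.I)).im =
      (∫ x in Ioi X, (wrightKernel η θ (x + β * Complex.I)).im) -
        ∫ y in β..Real.pi, (wrightKernel η θ (X + y * Complex.I)).re := by
    refine tendsto_nhds_unique
      (intervalIntegral_tendsto_integral_Ioi X hintπ.integrableOn tendsto_id) ?_
    have hlim := tendsto_integral_re_wrightKernel (η := η) (θ := θ) (c := Real.cos β) (y₀ := β)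
      (y₁ := Real.pi) (l := atTop) hθ.le hβ1.le
      (fun y hy => Real.cos_le_cos_of_nonneg_of_le_pi (by linarith [Real.pi_pos]) hy.2 hy.1.le)
      (by simpa using tendsto_wright_majorant_atTop hη0 hη1 (neg_pos.2 hcosβ) hθ.le)
    have := ((intervalIntegral_tendsto_integral_Ioi X hintβ.integrableOn tendsto_id).add
      hlim).sub (tendsto_const_nhds
        (x := ∫ y in β..Real.pi, (wrightKernel η θ (X + y * Complex.I)).re))
    rw [add_zero] at this
    refine this.congr fun x => ?_
    exact (integral_im_wrightKernel_rect η θ X x β Real.pi).symm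
  have hcy : Continuous (fun y : ℝ => (wrightKernel η θ (X + y * Complex.I)).re) :=
    Complex.continuous_re.comp ((continuous_wrightKernel_line η θ).comp
      (by fun_prop : Continuous fun y : ℝ => (X, y)))
  have hC := intervalIntegral.integral_add_adjacent_intervals
    (hcy.intervalIntegrable (μ := volume) 0 β) (hcy.intervalIntegrable β Real.pi)
  rw [xi_eq_integral hη0 hη1 hθ, ← intervalIntegral.integral_Iic_add_Ioi
    (b := X) hintπ.integrableOn hintπ.integrableOn, hA, hB, ← hC]
  congr 1; ring

/-- `ξ_η` decays faster than every exponential. -/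
theorem exists_abs_xi_le {η : ℝ} (hη0 : 0 < η) (hη1 : η < 1) (lam : ℝ) :
    ∃ C : ℝ, ∀ θ : ℝ, 0 < θ → |xi η θ| ≤ C * Real.exp (-lam * θ) := by
  have hπ := Real.pi_pos
  -- with this angle both `cos β < 0` and `cos (η β) > 0`
  set β : ℝ := Real.pi / (1 + η) with hβ
  have hβ0 : Real.pi / 2 < β := by rw [hβ]; gcongr; linarith
  have hβ1 : β < Real.pi := by rw [hβ, div_lt_iff₀ (by linarith)]; nlinarith
  have hηβ : η * β < Real.pi / 2 := by
    rw [hβ, ← mul_div_assoc, div_lt_div_iff₀ (by linarith) two_pos]; nlinarith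
  have hcosβ : Real.cos β < 0 := Real.cos_neg_of_pi_div_two_lt_of_lt hβ0 (by linarith)
  have hcosηβ : 0 < Real.cos (η * β) :=
    Real.cos_pos_of_mem_Ioo ⟨by nlinarith, hηβ⟩
  -- the radius `exp X` is chosen so large that `exp (η X) cos (η β) ≥ lam`
  obtain ⟨X, hX⟩ : ∃ X : ℝ, lam ≤ Real.exp (η * X) * Real.cos (η * β) := by
    refine ⟨Real.log ((|lam| + 1) / Real.cos (η * β)) / η, ?_⟩
    rw [mul_div_cancel₀ _ hη0.ne', Real.exp_log (by positivity), div_mul_cancel₀ _ hcosηβ.ne']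
    linarith [le_abs_self lam]
  set I₁ : ℝ := ∫ x in Ioi X, Real.exp (-(-Real.cos β) * Real.exp x + η * x) with hI₁
  refine ⟨(1 / Real.pi) * (I₁ + Real.exp (Real.exp X + η * X) * |β - 0|), fun θ hθ => ?_⟩
  rw [xi_eq_hankel hη0 hη1 hθ hβ0 hβ1 X, abs_mul, abs_of_pos (by positivity : 0 < 1 / Real.pi),
    mul_assoc]
  gcongr
  rw [add_mul]
  refine (abs_add_le _ _).trans (add_le_add ?_ ?_)
  · rw [hI₁, ← integral_mul_const]
    rw [← Real.norm_eq_abs]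
    refine norm_integral_le_of_norm_le (((integrable_exp_neg_mul_exp (neg_pos.2 hcosβ)
      hη0).integrableOn).mul_const _) ?_
    filter_upwards [ae_restrict_mem measurableSet_Ioi] with x hx
    refine (Complex.abs_im_le_norm _).trans ?_
    rw [norm_wrightKernel, ← Real.exp_add]
    apply Real.exp_le_exp.2
    have h1 : Real.exp (η * X) ≤ Real.exp (η * x) := by
      gcongr; exact le_of_lt hx
    have h2 := mul_le_mul_of_nonneg_right h1 hcosηβ.le
    nlinarith
  · rw [mul_right_comm, ← Real.norm_eq_abs]
    refine intervalIntegral.norm_integral_le_of_norm_le_const fun y hy => ?_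
    rw [uIoc_of_le (by linarith)] at hy
    refine (Complex.abs_re_le_norm _).trans ?_
    rw [norm_wrightKernel, ← Real.exp_add]
    apply Real.exp_le_exp.2
    have h1 : Real.cos (η * β) ≤ Real.cos (η * y) :=
      Real.cos_le_cos_of_nonneg_of_le_pi (by nlinarith [hy.1]) (by linarith)
        (by nlinarith [hy.2])
    have h2 := mul_le_mul_of_nonneg_left h1 (Real.exp_pos (η * X)).le
    have h3 := mul_le_of_le_one_right (Real.exp_pos X).le (Real.cos_le_one y)
    nlinarith

theorem aestronglyMeasurable_xi {η : ℝ} (hη0 : 0 < η) (hη1 : η < 1) :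
    AEStronglyMeasurable (xi η) (volume.restrict (Ioi 0)) := by
  have hc : Continuous (Function.uncurry fun (θ x : ℝ) =>
      (wrightKernel η θ (x + Real.pi * Complex.I)).im) := by
    unfold wrightKernel Function.uncurry
    fun_prop
  have h := (hc.stronglyMeasurable.integral_prod_right (ν := volume)).const_mul (1 / Real.pi)
  refine h.aestronglyMeasurable.congr ?_
  filter_upwards [ae_restrict_mem measurableSet_Ioi] with θ hθ
  exact (xi_eq_integral hη0 hη1 hθ).symm

/-! ### `C₀`-semigroups and the operators `T_η(t)` -/

section Semigroup

variable {Z : Type*} [NormedAddCommGroup Z] [NormedSpace ℝ Z] {T : ℝ → Z →L[ℝ] Z}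

theorem IsC0Semigroup.continuousWithinAt_zero (hT : IsC0Semigroup T) (x : Z) :
    Tendsto (fun s => T s x) (𝓝[≥] 0) (𝓝 x) := by
  have h : ContinuousWithinAt (fun s => T s x) (Ioi 0) 0 := by
    have := hT.tendsto_zero x
    rw [ContinuousWithinAt, hT.map_zero]; exact this
  have h' := continuousWithinAt_Ioi_iff_Ici.1 h
  rw [ContinuousWithinAt, hT.map_zero] at h'
  exact h'

/-- By the uniform boundedness principle a `C₀`-semigroup is bounded near `0`. -/
theorem IsC0Semigroup.exists_bound_near_zero [CompleteSpace Z] (hT : IsC0Semigroup T) :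
    ∃ δ > 0, ∃ K : ℝ, ∀ s ∈ Icc 0 δ, ‖T s‖ ≤ K := by
  by_contra! hcon
  choose s hs hsK using fun n : ℕ => hcon (1 / ((n : ℝ) + 1)) (by positivity) n
  have hs0 : Tendsto s atTop (𝓝[≥] 0) :=
    tendsto_nhdsWithin_iff.2 ⟨squeeze_zero (fun n => (hs n).1) (fun n => (hs n).2)
      tendsto_one_div_add_atTop_nhds_zero_nat, Eventually.of_forall fun n => (hs n).1⟩
  obtain ⟨C, hC⟩ := banach_steinhaus (g := fun n => T (s n)) fun x => by
    obtain ⟨C, hC⟩ := ((hT.continuousWithinAt_zero x).comp hs0).norm.bddAbove_range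
    exact ⟨C, fun n => hC ⟨n, rfl⟩⟩
  obtain ⟨n, hn⟩ := exists_nat_ge C
  linarith [hsK n, hC n]

theorem IsC0Semigroup.exists_exp_bound [CompleteSpace Z] (hT : IsC0Semigroup T) :
    ∃ C ω : ℝ, 0 ≤ C ∧ 0 ≤ ω ∧ ∀ t, 0 ≤ t → ‖T t‖ ≤ C * Real.exp (ω * t) := by
  obtain ⟨δ, hδ, K₀, hK₀⟩ := hT.exists_bound_near_zero
  set K := max K₀ 1 with hKdef
  have hK1 : 1 ≤ K := le_max_right _ _
  have hK : ∀ s ∈ Icc 0 δ, ‖T s‖ ≤ K := fun s hs => (hK₀ s hs).trans (le_max_left _ _)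
  have hpow : ∀ n : ℕ, ∀ s, 0 ≤ s → s ≤ (n + 1) * δ → ‖T s‖ ≤ K ^ (n + 1) := by
    intro n
    induction n with
    | zero => intro s h0 h1; simpa using hK s ⟨h0, by simpa using h1⟩
    | succ n ih =>
      intro s h0 h1
      rcases le_total s δ with h | h
      · exact (hK s ⟨h0, h⟩).trans (le_self_pow₀ hK1 (by simp))
      · have e : T s = (T δ).comp (T (s - δ)) := by
          rw [← hT.map_add _ _ hδ.le (by linarith)]; congr 1; ring
        rw [e, pow_succ']
        refine (ContinuousLinearMap.opNorm_comp_le _ _).trans ?_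
        gcongr
        · exact hK δ ⟨hδ.le, le_rfl⟩
        · exact ih _ (by linarith) (by push_cast at h1; linarith)
  refine ⟨K, Real.log K / δ, by linarith, div_nonneg (Real.log_nonneg hK1) hδ.le, fun t ht => ?_⟩
  have h1 : t ≤ (⌊t / δ⌋₊ + 1) * δ := by
    have := (Nat.lt_floor_add_one (t / δ)).le
    rwa [div_le_iff₀ hδ] at this
  refine (hpow _ t ht h1).trans ?_
  rw [pow_succ']
  gcongr
  rw [← Real.exp_log (by linarith : 0 < K), ← Real.exp_nat_mul, Real.log_exp]
  apply Real.exp_le_exp.2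
  have := mul_le_mul_of_nonneg_right (Nat.floor_le (div_nonneg ht hδ.le)) (Real.log_nonneg hK1)
  calc _ ≤ _ := this
    _ = _ := by ring

theorem IsC0Semigroup.continuousOn [CompleteSpace Z] (hT : IsC0Semigroup T) (x : Z) :
    ContinuousOn (fun t => T t x) (Ici 0) := by
  obtain ⟨C, ω, hC, hω, hb⟩ := hT.exists_exp_bound
  have key : ∀ s t, 0 ≤ s → s ≤ t →
      ‖T t x - T s x‖ ≤ C * Real.exp (ω * t) * ‖T |t - s| x - x‖ := by
    intro s t hs hst
    have e : T t x = T s (T |t - s| x) := by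
      rw [abs_of_nonneg (by linarith), ← ContinuousLinearMap.comp_apply,
        ← hT.map_add _ _ hs (by linarith)]
      congr 2; ring
    rw [e, ← map_sub]
    refine ((T s).le_opNorm _).trans ?_
    gcongr
    refine (hb s hs).trans ?_
    gcongr
  intro t₀ ht₀
  rw [ContinuousWithinAt, tendsto_iff_norm_sub_tendsto_zero]
  have habs : Tendsto (fun t => |t - t₀|) (𝓝[Ici 0] t₀) (𝓝[≥] 0) := by
    refine tendsto_nhdsWithin_iff.2 ⟨?_, Eventually.of_forall fun t => mem_Ici.2 (abs_nonneg _)⟩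
    have : Continuous fun t : ℝ => |t - t₀| := by fun_prop
    exact (this.tendsto' t₀ 0 (by simp)).mono_left nhdsWithin_le_nhds
  have h0 : Tendsto (fun t => ‖T |t - t₀| x - x‖) (𝓝[Ici 0] t₀) (𝓝 0) :=
    tendsto_iff_norm_sub_tendsto_zero.1 ((hT.continuousWithinAt_zero x).comp habs)
  have h1 := h0.const_mul (C * Real.exp (ω * (t₀ + 1)))
  rw [mul_zero] at h1
  have hnear : ∀ᶠ t in 𝓝[Ici 0] t₀, t ≤ t₀ + 1 :=
    nhdsWithin_le_nhds (eventually_le_nhds (by linarith))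
  refine squeeze_zero' (Eventually.of_forall fun t => norm_nonneg _) ?_ h1
  filter_upwards [hnear, self_mem_nhdsWithin] with t ht ht0
  rcases le_total t t₀ with h | h
  · rw [norm_sub_rev, abs_sub_comm]
    refine (key t t₀ ht0 h).trans ?_
    gcongr; linarith
  · refine (key t₀ t ht₀ h).trans ?_
    gcongr

end Semigroup

section FracOp

variable {Z : Type*} [NormedAddCommGroup Z] [NormedSpace ℝ Z] [CompleteSpace Z]
  {T : ℝ → Z →L[ℝ] Z} {η : ℝ}

/-- An integrable majorant, uniform in `t ∈ [0, a]`, of the integrand that defines `T_η(t) x`. -/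
theorem exists_fracOp_majorant (hη0 : 0 < η) (hη1 : η < 1) (hT : IsC0Semigroup T) (a : ℝ) :
    ∃ g : ℝ → ℝ, IntegrableOn g (Ioi 0) ∧ (∀ θ, 0 < θ → 0 ≤ g θ) ∧
      ∀ t ∈ Icc 0 a, ∀ θ, 0 < θ → ∀ x : Z,
        ‖(θ * xi η θ) • T (t ^ η * θ) x‖ ≤ g θ * ‖x‖ := by
  obtain ⟨C, ω, hC, hω, hb⟩ := hT.exists_exp_bound
  obtain ⟨D, hD⟩ := exists_abs_xi_le hη0 hη1 (ω * a ^ η + 1)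
  have hD0 : 0 ≤ D := by
    have := (abs_nonneg _).trans (hD 1 one_pos)
    exact nonneg_of_mul_nonneg_left this (Real.exp_pos _)
  refine ⟨fun θ => C * D * (θ ^ (1 : ℝ) * Real.exp (-1 * θ ^ (1 : ℝ))),
    (integrableOn_rpow_mul_exp_neg_mul_rpow (by norm_num) one_pos one_pos).const_mul _,
    fun θ hθ => by positivity, fun t ht θ hθ x => ?_⟩
  have ha : 0 ≤ a := ht.1.trans ht.2
  have h1 : ‖T (t ^ η * θ)‖ ≤ C * Real.exp (ω * (a ^ η * θ)) := by
    refine (hb _ (mul_nonneg (Real.rpow_nonneg ht.1 _) hθ.le)).trans ?_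
    have := Real.rpow_le_rpow ht.1 ht.2 hη0.le
    gcongr
  simp only [norm_smul, norm_mul, Real.norm_of_nonneg hθ.le, Real.norm_eq_abs, Real.rpow_one]
  calc θ * |xi η θ| * ‖T (t ^ η * θ) x‖
      ≤ θ * (D * Real.exp (-(ω * a ^ η + 1) * θ)) *
          ((C * Real.exp (ω * (a ^ η * θ))) * ‖x‖) := by
        gcongr
        · exact hD θ hθ
        · exact ((T _).le_opNorm x).trans (by gcongr)
    _ = C * D * θ * (Real.exp (-(ω * a ^ η + 1) * θ) * Real.exp (ω * (a ^ η * θ))) * ‖x‖ := by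
        ring
    _ = _ := by
        rw [← Real.exp_add]; ring_nf

theorem aestronglyMeasurable_fracOp_integrand (hη0 : 0 < η) (hη1 : η < 1)
    (hT : IsC0Semigroup T) {t : ℝ} (ht : 0 ≤ t) (x : Z) :
    AEStronglyMeasurable (fun θ => (θ * xi η θ) • T (t ^ η * θ) x)
      (volume.restrict (Ioi 0)) := by
  refine (measurable_id.aestronglyMeasurable.mul (aestronglyMeasurable_xi hη0 hη1)).smul
    (ContinuousOn.aestronglyMeasurable ?_ measurableSet_Ioi)
  exact (hT.continuousOn x).comp (by fun_prop)
    fun θ hθ => mul_nonneg (Real.rpow_nonneg ht _) (le_of_lt hθ)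

/-- On `[0, a]` the family `T_η(t)` consists of uniformly bounded operators and is strongly
continuous. The extension `S` of it to all times is constant outside of `[0, a]`. -/
theorem exists_fracOp_eq_clm (hη0 : 0 < η) (hη1 : η < 1) (hT : IsC0Semigroup T) {a : ℝ}
    (ha : 0 ≤ a) :
    ∃ (S : ℝ → Z →L[ℝ] Z) (K : ℝ), 0 ≤ K ∧ (∀ t, ‖S t‖ ≤ K) ∧
      Continuous (fun q : ℝ × Z => S q.1 q.2) ∧
      ∀ t ∈ Icc 0 a, ∀ x, fracOp η T t x = S t x := by
  obtain ⟨g, hg, hg0, hgT⟩ := exists_fracOp_majorant hη0 hη1 hT a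
  have hint : ∀ t ∈ Icc 0 a, ∀ x : Z,
      IntegrableOn (fun θ => (θ * xi η θ) • T (t ^ η * θ) x) (Ioi 0) := fun t ht x =>
    (hg.mul_const ‖x‖).mono' (aestronglyMeasurable_fracOp_integrand hη0 hη1 hT ht.1 x)
      (by filter_upwards [ae_restrict_mem measurableSet_Ioi] with θ hθ using hgT t ht θ hθ x)
  set K : ℝ := η * ∫ θ in Ioi 0, g θ with hK
  have hK0 : 0 ≤ K := mul_nonneg hη0.le (setIntegral_nonneg measurableSet_Ioi hg0)
  have hbound : ∀ t ∈ Icc 0 a, ∀ x : Z, ‖fracOp η T t x‖ ≤ K * ‖x‖ := by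
    intro t ht x
    rw [fracOp, norm_smul, Real.norm_of_nonneg hη0.le, hK, mul_assoc, ← integral_mul_const]
    gcongr
    refine norm_integral_le_of_norm_le (hg.mul_const _) ?_
    filter_upwards [ae_restrict_mem measurableSet_Ioi] with θ hθ using hgT t ht θ hθ x
  have hcont : ∀ x : Z, ContinuousOn (fun t => fracOp η T t x) (Icc 0 a) := by
    intro x t₀ ht₀
    refine ContinuousWithinAt.const_smul ?_ η
    refine continuousWithinAt_of_dominated (bound := fun θ => g θ * ‖x‖) ?_ ?_
      (hg.mul_const _) ?_
    · filter_upwards [self_mem_nhdsWithin] with t ht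
      exact aestronglyMeasurable_fracOp_integrand hη0 hη1 hT ht.1 x
    · filter_upwards [self_mem_nhdsWithin] with t ht
      filter_upwards [ae_restrict_mem measurableSet_Ioi] with θ hθ using hgT t ht θ hθ x
    · filter_upwards [ae_restrict_mem measurableSet_Ioi] with θ hθ
      refine ContinuousWithinAt.const_smul ?_ _
      refine ContinuousWithinAt.comp (t := Ici 0) (f := fun t : ℝ => t ^ η * θ)
        (g := fun s => T s x) (hT.continuousOn x _ ?_) ?_ ?_
      · exact mul_nonneg (Real.rpow_nonneg ht₀.1 _) (le_of_lt hθ)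
      · exact ((Real.continuous_rpow_const hη0.le).mul continuous_const).continuousWithinAt
      · exact fun t ht => mul_nonneg (Real.rpow_nonneg ht.1 _) (le_of_lt hθ)
  have hclamp : ∀ t : ℝ, max 0 (min t a) ∈ Icc 0 a := fun t =>
    ⟨le_max_left _ _, max_le ha (min_le_right _ _)⟩
  let S : ℝ → Z →L[ℝ] Z := fun t =>
    LinearMap.mkContinuous
      { toFun := fun x => fracOp η T (max 0 (min t a)) x
        map_add' := fun x y => by
          simp only [fracOp, map_add, smul_add]
          rw [integral_add (hint _ (hclamp t) x) (hint _ (hclamp t) y), smul_add]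
        map_smul' := fun c x => by
          simp only [fracOp, map_smul, RingHom.id_apply]
          rw [smul_comm c η, ← integral_smul c]
          simp_rw [smul_comm c (_ * _)] } K (hbound _ (hclamp t))
  have hS : ∀ t x, S t x = fracOp η T (max 0 (min t a)) x := fun t x => rfl
  have hSK : ∀ t, ‖S t‖ ≤ K := fun t => LinearMap.mkContinuous_norm_le _ hK0 _
  refine ⟨S, K, hK0, hSK, ?_, fun t ht x => ?_⟩
  · rw [continuous_iff_continuousAt]
    rintro ⟨t₀, x₀⟩
    rw [ContinuousAt, tendsto_iff_norm_sub_tendsto_zero]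
    have hSx : Continuous fun t => S t x₀ :=
      (hcont x₀).comp_continuous (f := fun t : ℝ => max 0 (min t a)) (by fun_prop) hclamp
    have h1 : Continuous fun q : ℝ × Z => K * ‖q.2 - x₀‖ + ‖S q.1 x₀ - S t₀ x₀‖ := by
      have := hSx.comp (continuous_fst (X := ℝ) (Y := Z))
      simp only [Function.comp_def] at this
      fun_prop
    refine squeeze_zero (fun q => norm_nonneg _) (fun q => ?_)
      (h1.tendsto' (t₀, x₀) 0 (by simp))
    calc ‖S q.1 q.2 - S t₀ x₀‖ = ‖S q.1 (q.2 - x₀) + (S q.1 x₀ - S t₀ x₀)‖ := by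
          rw [map_sub]; congr 1; abel
      _ ≤ _ := (norm_add_le _ _).trans (by
          gcongr
          exact (S q.1).le_of_opNorm_le (hSK _) _)
  · rw [hS, min_eq_left ht.2, max_eq_right ht.1]

end FracOp

/-! ### Abel-type convolutions -/

section Kernels

theorem intervalIntegrable_sub_rpow {α : ℝ} (hα : α < 1) (x τ : ℝ) :
    IntervalIntegrable (fun s => (τ - s) ^ (-α)) volume x τ := by
  have h := (intervalIntegral.intervalIntegrable_rpow' (a := τ - x) (b := 0)
    (by linarith : -1 < -α)).comp_sub_left τ
  simpa using h

theorem integral_sub_rpow {α : ℝ} (hα : α < 1) (x τ : ℝ) :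
    ∫ s in x..τ, (τ - s) ^ (-α) = (τ - x) ^ (1 - α) / (1 - α) := by
  rw [intervalIntegral.integral_comp_sub_left (fun u => u ^ (-α)) τ,
    integral_rpow (Or.inl (by linarith)), sub_self, neg_add_eq_sub,
    Real.zero_rpow (by linarith), sub_zero]

theorem intervalIntegrable_rpow_sub {β : ℝ} (hβ : β < 1) (p τ : ℝ) :
    IntervalIntegrable (fun s => (s - p) ^ (-β)) volume p τ := by
  have h := (intervalIntegral.intervalIntegrable_rpow' (a := 0) (b := τ - p)
    (by linarith : -1 < -β)).comp_sub_right p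
  simpa using h

theorem integral_rpow_sub {β : ℝ} (hβ : β < 1) (p τ : ℝ) :
    ∫ s in p..τ, (s - p) ^ (-β) = (τ - p) ^ (1 - β) / (1 - β) := by
  rw [intervalIntegral.integral_comp_sub_right (fun u => u ^ (-β)) p,
    integral_rpow (Or.inl (by linarith)), sub_self, neg_add_eq_sub,
    Real.zero_rpow (by linarith), sub_zero]

/-- Bound for the Beta integral, obtained by splitting `(p, τ)` at its midpoint. -/
theorem beta_integral_le {α β : ℝ} (hα0 : 0 ≤ α) (hα : α < 1) (hβ0 : 0 ≤ β) (hβ : β < 1)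
    {p τ : ℝ} (hpτ : p < τ) :
    IntegrableOn (fun s => (τ - s) ^ (-α) * (s - p) ^ (-β)) (Ioc p τ) ∧
      ∫ s in Ioc p τ, (τ - s) ^ (-α) * (s - p) ^ (-β) ≤
        (2 ^ α / (1 - β) + 2 ^ β / (1 - α)) * (τ - p) ^ (1 - α - β) := by
  set L := τ - p with hL
  have hL0 : 0 < L := by rw [hL]; linarith
  set g : ℝ → ℝ := fun s =>
    (L / 2) ^ (-α) * (s - p) ^ (-β) + (L / 2) ^ (-β) * (τ - s) ^ (-α) with hg
  have hi1 := (intervalIntegrable_rpow_sub hβ p τ).const_mul ((L / 2) ^ (-α))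
  have hi2 := (intervalIntegrable_sub_rpow hα p τ).const_mul ((L / 2) ^ (-β))
  have hgint : IntegrableOn g (Ioc p τ) :=
    (intervalIntegrable_iff_integrableOn_Ioc_of_le hpτ.le).1 (hi1.add hi2)
  have hle : ∀ᵐ s ∂(volume.restrict (Ioc p τ)),
      ‖(τ - s) ^ (-α) * (s - p) ^ (-β)‖ ≤ g s := by
    rw [← restrict_Ioo_eq_restrict_Ioc]
    filter_upwards [ae_restrict_mem measurableSet_Ioo] with s hs
    have h1 : 0 < τ - s := by linarith [hs.2]
    have h2 : 0 < s - p := by linarith [hs.1]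
    rw [Real.norm_of_nonneg (by positivity), hg]
    rcases le_total (L / 2) (τ - s) with h | h
    · have := Real.rpow_le_rpow_of_nonpos (by positivity) h (neg_nonpos.2 hα0)
      have h3 := mul_le_mul_of_nonneg_right this (Real.rpow_nonneg h2.le (-β))
      have : 0 ≤ (L / 2) ^ (-β) * (τ - s) ^ (-α) := by positivity
      simp only; linarith
    · have := Real.rpow_le_rpow_of_nonpos (by positivity)
        (by linarith : L / 2 ≤ s - p) (neg_nonpos.2 hβ0)
      have h3 := mul_le_mul_of_nonneg_right this (Real.rpow_nonneg h1.le (-α))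
      have : 0 ≤ (L / 2) ^ (-α) * (s - p) ^ (-β) := by positivity
      simp only; linarith
  have hmeas : AEStronglyMeasurable (fun s => (τ - s) ^ (-α) * (s - p) ^ (-β))
      (volume.restrict (Ioc p τ)) := by
    apply Measurable.aestronglyMeasurable; fun_prop
  have hint := hgint.mono' hmeas hle
  refine ⟨hint, ?_⟩
  refine (integral_mono_ae hint hgint (hle.mono fun s hs => (le_abs_self _).trans hs)).trans ?_
  rw [← intervalIntegral.integral_of_le hpτ.le, hg, intervalIntegral.integral_add hi1 hi2,
    intervalIntegral.integral_const_mul, intervalIntegral.integral_const_mul,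
    integral_rpow_sub hβ, integral_sub_rpow hα, ← hL, Real.div_rpow hL0.le two_pos.le,
    Real.div_rpow hL0.le two_pos.le, Real.rpow_neg two_pos.le, Real.rpow_neg two_pos.le]
  have e1 : L ^ (1 - α - β) = L ^ (-α) * L ^ (1 - β) := by
    rw [← Real.rpow_add hL0]; congr 1; ring
  have e2 : L ^ (1 - α - β) = L ^ (-β) * L ^ (1 - α) := by
    rw [← Real.rpow_add hL0]; congr 1; ring
  rw [add_mul]
  nth_rewrite 2 [e2]
  rw [e1]
  simp only [div_eq_mul_inv, inv_inv]
  exact le_of_eq (by ring)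

/-- Hölder's inequality for the kernel `(τ - s) ^ (η - 1)`, which is in the dual of `L^q` because
`q > 1 / η`. -/
theorem exists_kernel_holder_bound {η q p t : ℝ} (hη0 : 0 < η) (hη1 : η < 1) (hq : 1 / η < q)
    {l : ℝ → ℝ} (hl : MemLp l (ENNReal.ofReal q) (volume.restrict (Ioc p t))) :
    ∃ C : ℝ, 0 ≤ C ∧ ∀ x τ, p ≤ x → x ≤ τ → τ ≤ t →
      IntegrableOn (fun s => (τ - s) ^ (η - 1) * |l s|) (Ioc x τ) ∧
        ∫ s in Ioc x τ, (τ - s) ^ (η - 1) * |l s| ≤ C * (τ - x) ^ (η - 1 / q) := by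
  have hq1 : 1 < q := lt_of_le_of_lt (by rw [le_div_iff₀ hη0]; linarith) hq
  have hconj : (Real.conjExponent q).HolderConjugate q :=
    (Real.HolderConjugate.conjExponent hq1).symm
  set q' := Real.conjExponent q with hq'
  have hq'0 : 0 < q' := hconj.pos
  have hinv : 1 / q' = 1 - 1 / q := by
    have := hconj.inv_add_inv_eq_one; simp only [one_div]; linarith
  have hηq : 1 / q < η := by
    rw [div_lt_iff₀ hη0] at hq; rw [div_lt_iff₀ (by linarith)]; linarith
  -- the exponent of the kernel in the conjugate Lebesgue space
  set α := (1 - η) * q' with hα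
  have hα1 : α < 1 := by
    have : (1 - η) < 1 / q' := by rw [hinv]; linarith
    rwa [lt_div_iff₀ hq'0] at this
  set N := (∫ s in Ioc p t, |l s| ^ q) ^ (1 / q) with hN
  have hN0 : 0 ≤ N := Real.rpow_nonneg
    (setIntegral_nonneg measurableSet_Ioc fun s _ => Real.rpow_nonneg (abs_nonneg _) _) _
  have h1α : 0 < 1 - α := by linarith
  refine ⟨(1 / (1 - α)) ^ (1 / q') * N, by positivity, fun x τ hpx hxτ hτt => ?_⟩
  have hsub : Ioc x τ ⊆ Ioc p t := Ioc_subset_Ioc hpx hτt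
  have hkpow : ∀ s ∈ Ioc x τ, ((τ - s) ^ (η - 1)) ^ q' = (τ - s) ^ (-α) := by
    intro s hs
    rw [← Real.rpow_mul (by linarith [hs.2])]; congr 1; rw [hα]; ring
  have hkm : AEStronglyMeasurable (fun s => (τ - s) ^ (η - 1)) (volume.restrict (Ioc x τ)) := by
    apply Measurable.aestronglyMeasurable; fun_prop
  have hkα : IntegrableOn (fun s => (τ - s) ^ (-α)) (Ioc x τ) :=
    (intervalIntegrable_iff_integrableOn_Ioc_of_le hxτ).1 (intervalIntegrable_sub_rpow hα1 x τ)
  have hk : MemLp (fun s => (τ - s) ^ (η - 1)) (ENNReal.ofReal q')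
      (volume.restrict (Ioc x τ)) := by
    rw [← integrable_norm_rpow_iff hkm (by simpa using hq'0) ENNReal.ofReal_ne_top,
      ENNReal.toReal_ofReal hq'0.le]
    refine hkα.congr ?_
    filter_upwards [ae_restrict_mem measurableSet_Ioc] with s hs
    rw [Real.norm_of_nonneg (Real.rpow_nonneg (by linarith [hs.2]) _), hkpow s hs]
  have hl' : MemLp (fun s => |l s|) (ENNReal.ofReal q) (volume.restrict (Ioc x τ)) :=
    (hl.mono_measure (Measure.restrict_mono hsub le_rfl)).norm
  have hint : IntegrableOn (fun s => (τ - s) ^ (η - 1) * |l s|) (Ioc x τ) := by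
    have : (ENNReal.ofReal q').HolderConjugate (ENNReal.ofReal q) := hconj.ennrealOfReal
    exact hk.integrable_mul hl'
  refine ⟨hint, ?_⟩
  refine (integral_mul_le_Lp_mul_Lq_of_nonneg hconj ?_
    (Eventually.of_forall fun s => abs_nonneg _) hk hl').trans ?_
  · filter_upwards [ae_restrict_mem measurableSet_Ioc] with s hs
    exact Real.rpow_nonneg (by linarith [hs.2]) _
  rw [setIntegral_congr_fun measurableSet_Ioc hkpow, ← intervalIntegral.integral_of_le hxτ,
    integral_sub_rpow hα1]
  have h0 : 0 ≤ τ - x := by linarith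
  have e : ((τ - x) ^ (1 - α) / (1 - α)) ^ (1 / q') =
      (1 / (1 - α)) ^ (1 / q') * (τ - x) ^ (η - 1 / q) := by
    rw [div_eq_mul_one_div, Real.mul_rpow (by positivity) (by positivity), mul_comm,
      ← Real.rpow_mul h0]
    congr 2
    rw [sub_mul, hα, mul_assoc, mul_one_div_cancel hq'0.ne', hinv]; ring
  rw [e, mul_assoc, mul_assoc, mul_comm N]
  have hmono : (∫ s in Ioc x τ, |l s| ^ q) ^ (1 / q) ≤ N := by
    rw [hN]
    refine Real.rpow_le_rpow (setIntegral_nonneg measurableSet_Ioc fun s _ => by positivity)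
      (setIntegral_mono_set ?_ (Eventually.of_forall fun s => by positivity)
        hsub.eventuallyLE) (by positivity)
    have := hl.integrable_norm_rpow (by simpa using (by linarith : 0 < q)) ENNReal.ofReal_ne_top
    rwa [ENNReal.toReal_ofReal (by linarith)] at this
  gcongr

end Kernels

/-- Strongly measurable functions on `(p, t]` that are dominated by the sum of a function in `L^q`
and a multiple of `(s - p) ^ (-γ)`. -/
structure SingularLp {Z : Type*} [NormedAddCommGroup Z] (q γ p t : ℝ) (g : ℝ → Z) : Prop where
  aestronglyMeasurable : AEStronglyMeasurable g (volume.restrict (Ioc p t))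
  bound : ∃ (l : ℝ → ℝ) (C : ℝ), MemLp l (ENNReal.ofReal q) (volume.restrict (Ioc p t)) ∧ 0 ≤ C ∧
    ∀ᵐ s ∂(volume.restrict (Ioc p t)), ‖g s‖ ≤ |l s| + C * (s - p) ^ (-γ)

namespace SingularLp

variable {Z : Type*} [NormedAddCommGroup Z] {η q γ p t : ℝ} {f g : ℝ → Z}

theorem add (hf : SingularLp q γ p t f) (hg : SingularLp q γ p t g) :
    SingularLp q γ p t (fun s => f s + g s) := by
  obtain ⟨l, C, hl, hC, hb⟩ := hf.bound
  obtain ⟨l', C', hl', hC', hb'⟩ := hg.bound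
  refine ⟨hf.aestronglyMeasurable.add hg.aestronglyMeasurable,
    fun s => |l s| + |l' s|, C + C', hl.norm.add hl'.norm, by positivity, ?_⟩
  filter_upwards [hb, hb'] with s h1 h2
  rw [abs_of_nonneg (by positivity)]
  linarith [norm_add_le (f s) (g s)]

theorem of_memLp (hf : MemLp f (ENNReal.ofReal q) (volume.restrict (Ioc p t))) :
    SingularLp q γ p t f :=
  ⟨hf.aestronglyMeasurable, fun s => ‖f s‖, 0, hf.norm, le_rfl,
    Eventually.of_forall fun s => by simp⟩

theorem zero : SingularLp q γ p t (fun _ => (0 : Z)) :=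
  of_memLp MemLp.zero'

theorem sum {ι : Type*} {g : ι → ℝ → Z} (I : Finset ι)
    (hg : ∀ i ∈ I, SingularLp q γ p t (g i)) : SingularLp q γ p t (fun s => ∑ i ∈ I, g i s) := by
  classical
  induction I using Finset.induction_on with
  | empty => simpa using zero
  | insert i I hi ih =>
    simp_rw [Finset.sum_insert hi]
    exact (hg i (Finset.mem_insert_self i I)).add
      (ih fun j hj => hg j (Finset.mem_insert_of_mem hj))

/-- A singularity of order `β ≤ γ` at `p` is also one of order `γ`. -/
theorem of_norm_le {β C : ℝ} (hβγ : β ≤ γ)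
    (hf : AEStronglyMeasurable f (volume.restrict (Ioc p t))) (hC : 0 ≤ C)
    (hb : ∀ s ∈ Ioc p t, ‖f s‖ ≤ C * (s - p) ^ (-β)) : SingularLp q γ p t f := by
  refine ⟨hf, fun _ => 0, C * |t - p| ^ (γ - β), MemLp.zero', by positivity, ?_⟩
  · filter_upwards [ae_restrict_mem measurableSet_Ioc] with s hs
    have h0 : 0 < s - p := by linarith [hs.1]
    refine (hb s hs).trans ?_
    rw [abs_zero, zero_add, mul_assoc]
    gcongr
    have : (s - p) ^ (-β) = (s - p) ^ (γ - β) * (s - p) ^ (-γ) := by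
      rw [← Real.rpow_add h0]; congr 1; ring
    rw [this]
    gcongr
    exact (sub_le_sub_right hs.2 p).trans (le_abs_self _)

/-- The basic estimate for the Abel-type convolution with a singular function: over all of
`(p, τ]`, and over short intervals away from `p`. -/
theorem exists_kernel_bound (hη0 : 0 < η) (hη1 : η < 1) (hq : 1 / η < q) (hγ0 : 0 ≤ γ)
    (hγ1 : γ < 1) (hg : SingularLp q γ p t g) :
    ∃ C : ℝ, 0 ≤ C ∧ ∀ τ ∈ Ioc p t,
      IntegrableOn (fun s => (τ - s) ^ (η - 1) * ‖g s‖) (Ioc p τ) ∧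
      ∫ s in Ioc p τ, (τ - s) ^ (η - 1) * ‖g s‖ ≤
        C * (τ - p) ^ (η - 1 / q) + C * (τ - p) ^ (η - γ) ∧
      ∀ x, p < x → x ≤ τ → ∫ s in Ioc x τ, (τ - s) ^ (η - 1) * ‖g s‖ ≤
        C * (τ - x) ^ (η - 1 / q) + C * (x - p) ^ (-γ) * (τ - x) ^ η := by
  obtain ⟨l, C, hl, hC, hb⟩ := hg.bound
  obtain ⟨D, hD, hDb⟩ := exists_kernel_holder_bound hη0 hη1 hq hl
  set E : ℝ := 2 ^ (1 - η) / (1 - γ) + 2 ^ γ / (1 - (1 - η)) with hE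
  have hE0 : 0 ≤ E := by
    have h1 : 0 < 1 - γ := by linarith
    have h2 : 0 < 1 - (1 - η) := by linarith
    positivity
  refine ⟨D + C * E + C / η, by positivity, fun τ hτ => ?_⟩
  obtain ⟨hDi, hDle⟩ := hDb p τ le_rfl hτ.1.le hτ.2
  obtain ⟨hBi, hBle⟩ := beta_integral_le (α := 1 - η) (by linarith) (by linarith) hγ0 hγ1 hτ.1
  simp only [neg_sub] at hBi hBle
  have hm := hDi.add (hBi.const_mul C)
  have hle : ∀ᵐ s ∂(volume.restrict (Ioc p τ)), ‖(τ - s) ^ (η - 1) * ‖g s‖‖ ≤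
      (τ - s) ^ (η - 1) * |l s| + C * ((τ - s) ^ (η - 1) * (s - p) ^ (-γ)) := by
    filter_upwards [ae_restrict_mem measurableSet_Ioc,
      ae_restrict_of_ae_restrict_of_subset (Ioc_subset_Ioc_right hτ.2) hb] with s hs hsb
    have h0 : 0 ≤ (τ - s) ^ (η - 1) := Real.rpow_nonneg (by linarith [hs.2]) _
    rw [norm_mul, norm_norm, Real.norm_of_nonneg h0]
    calc _ ≤ (τ - s) ^ (η - 1) * (|l s| + C * (s - p) ^ (-γ)) := by gcongr
      _ = _ := by ring
  have hint : IntegrableOn (fun s => (τ - s) ^ (η - 1) * ‖g s‖) (Ioc p τ) := by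
    refine hm.mono' (AEStronglyMeasurable.mul ?_
      (hg.aestronglyMeasurable.mono_measure
        (Measure.restrict_mono (Ioc_subset_Ioc_right hτ.2) le_rfl)).norm) hle
    apply Measurable.aestronglyMeasurable; fun_prop
  have hL : 0 < τ - p := by linarith [hτ.1]
  refine ⟨hint, ?_, fun x hpx hxτ => ?_⟩
  · refine (integral_mono_ae hint hm (hle.mono fun s hs => (le_abs_self _).trans hs)).trans ?_
    rw [Pi.add_def, integral_add hDi (hBi.const_mul C), integral_const_mul]
    have e : (1 : ℝ) - (1 - η) - γ = η - γ := by ring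
    rw [e] at hBle
    have h1 : C * ∫ s in Ioc p τ, (τ - s) ^ (η - 1) * (s - p) ^ (-γ) ≤
        C * E * (τ - p) ^ (η - γ) := by
      rw [mul_assoc]; gcongr
    refine add_le_add (hDle.trans ?_) (h1.trans ?_)
    · gcongr; rw [add_assoc]; exact le_add_of_nonneg_right (by positivity)
    · gcongr
      have : 0 ≤ C / η := by positivity
      linarith
  · have hsub : Ioc x τ ⊆ Ioc p τ := Ioc_subset_Ioc_left hpx.le
    obtain ⟨hDi', hDle'⟩ := hDb x τ hpx.le hxτ hτ.2
    have hki : IntegrableOn (fun s => (τ - s) ^ (η - 1)) (Ioc x τ) := by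
      have := (intervalIntegrable_iff_integrableOn_Ioc_of_le hxτ).1
        (intervalIntegrable_sub_rpow (α := 1 - η) (by linarith) x τ)
      simpa only [neg_sub] using this
    have hkv : ∫ s in Ioc x τ, (τ - s) ^ (η - 1) = (τ - x) ^ η / η := by
      rw [← intervalIntegral.integral_of_le hxτ]
      simpa using integral_sub_rpow (α := 1 - η) (by linarith) x τ
    have hx0 : 0 < x - p := by linarith
    refine (integral_mono_ae (g := fun s => (τ - s) ^ (η - 1) * |l s| +
      C * (x - p) ^ (-γ) * (τ - s) ^ (η - 1)) (hint.mono_set hsub)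
      (hDi'.add (hki.const_mul _)) ?_).trans ?_
    · filter_upwards [ae_restrict_mem measurableSet_Ioc,
        ae_restrict_of_ae_restrict_of_subset hsub hle] with s hs hsb
      refine (le_abs_self _).trans (hsb.trans ?_)
      have h0 : 0 ≤ (τ - s) ^ (η - 1) := Real.rpow_nonneg (by linarith [hs.2]) _
      have h1 : (s - p) ^ (-γ) ≤ (x - p) ^ (-γ) :=
        Real.rpow_le_rpow_of_nonpos hx0 (by linarith [hs.1]) (by linarith)
      rw [mul_assoc C, mul_comm ((x - p) ^ (-γ))]
      gcongr
    · rw [integral_add hDi' (hki.const_mul _), integral_const_mul, hkv]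
      refine add_le_add (hDle'.trans ?_) ?_
      · have h0 : 0 ≤ (τ - x) ^ (η - 1 / q) := Real.rpow_nonneg (by linarith) _
        gcongr
        rw [add_assoc]; exact le_add_of_nonneg_right (by positivity)
      · have e : C * (x - p) ^ (-γ) * ((τ - x) ^ η / η) =
          (C / η) * (x - p) ^ (-γ) * (τ - x) ^ η := by ring
        rw [e]
        have h0 : 0 ≤ (τ - x) ^ η := Real.rpow_nonneg (by linarith) _
        gcongr
        exact le_add_of_nonneg_left (by positivity)

theorem integrableOn (hη0 : 0 < η) (hη1 : η < 1) (hq : 1 / η < q) (hγ1 : γ < 1)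
    (hg : SingularLp q γ p t g) : IntegrableOn g (Ioc p t) := by
  obtain ⟨l, C, hl, hC, hb⟩ := hg.bound
  rcases le_total t p with h | h
  · simp [Ioc_eq_empty_of_le h]
  have hq1 : 1 ≤ ENNReal.ofReal q := by
    rw [← ENNReal.ofReal_one]
    exact ENNReal.ofReal_le_ofReal (le_trans (by rw [le_div_iff₀ hη0]; linarith) hq.le)
  have h1 : IntegrableOn (fun s => |l s|) (Ioc p t) := hl.norm.integrable hq1
  have h2 := (intervalIntegrable_iff_integrableOn_Ioc_of_le h).1
    (intervalIntegrable_rpow_sub hγ1 p t)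
  exact (h1.add (h2.const_mul C)).mono' hg.aestronglyMeasurable hb

end SingularLp

section Convolution

variable {Z : Type*} [NormedAddCommGroup Z] [NormedSpace ℝ Z] {η q γ p t K : ℝ} {g : ℝ → Z}
  {S : ℝ → Z →L[ℝ] Z}

theorem aestronglyMeasurable_kernel_smul (hS : Continuous (fun r : ℝ × Z => S r.1 r.2))
    {s : Set ℝ} (hg : AEStronglyMeasurable g (volume.restrict s)) (τ : ℝ) :
    AEStronglyMeasurable (fun s => (τ - s) ^ (η - 1) • S (τ - s) (g s)) (volume.restrict s) := by
  refine AEStronglyMeasurable.smul ?_ (hS.comp_aestronglyMeasurable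
    (AEStronglyMeasurable.prodMk (f := fun s : ℝ => τ - s) ?_ hg))
  · apply Measurable.aestronglyMeasurable; fun_prop
  · apply Measurable.aestronglyMeasurable; fun_prop

theorem norm_kernel_smul_le (hSK : ∀ u, ‖S u‖ ≤ K) {τ s : ℝ} (hs : s ≤ τ) (z : Z) :
    ‖(τ - s) ^ (η - 1) • S (τ - s) z‖ ≤ K * ((τ - s) ^ (η - 1) * ‖z‖) := by
  have h0 : 0 ≤ (τ - s) ^ (η - 1) := Real.rpow_nonneg (by linarith) _
  rw [norm_smul, Real.norm_of_nonneg h0, mul_left_comm]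
  gcongr
  exact (S _).le_of_opNorm_le (hSK _) _

theorem SingularLp.intervalIntegrable_kernel (hη0 : 0 < η) (hη1 : η < 1) (hq : 1 / η < q)
    (hγ0 : 0 ≤ γ) (hγ1 : γ < 1) (hS : Continuous (fun r : ℝ × Z => S r.1 r.2))
    (hSK : ∀ u, ‖S u‖ ≤ K) (hg : SingularLp q γ p t g) {τ : ℝ} (hτ : τ ∈ Ioc p t) :
    IntervalIntegrable (fun s => (τ - s) ^ (η - 1) • S (τ - s) (g s)) volume p τ := by
  obtain ⟨C, -, hC⟩ := hg.exists_kernel_bound hη0 hη1 hq hγ0 hγ1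
  rw [intervalIntegrable_iff_integrableOn_Ioc_of_le hτ.1.le]
  refine ((hC τ hτ).1.const_mul K).mono' (aestronglyMeasurable_kernel_smul hS
    (hg.aestronglyMeasurable.mono_measure
      (Measure.restrict_mono (Ioc_subset_Ioc_right hτ.2) le_rfl)) τ) ?_
  filter_upwards [ae_restrict_mem measurableSet_Ioc] with s hs
  exact norm_kernel_smul_le hSK hs.2 _

theorem SingularLp.norm_integral_kernel_le (hη0 : 0 < η) (hη1 : η < 1) (hq : 1 / η < q)
    (hγ0 : 0 ≤ γ) (hγ1 : γ < 1) (hSK : ∀ u, ‖S u‖ ≤ K) (hg : SingularLp q γ p t g) {x τ : ℝ}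
    (hτ : τ ∈ Ioc p t) (hpx : p ≤ x) (hxτ : x ≤ τ) :
    ‖∫ s in x..τ, (τ - s) ^ (η - 1) • S (τ - s) (g s)‖ ≤
      K * ∫ s in Ioc x τ, (τ - s) ^ (η - 1) * ‖g s‖ := by
  obtain ⟨C, -, hC⟩ := hg.exists_kernel_bound hη0 hη1 hq hγ0 hγ1
  rw [intervalIntegral.integral_of_le hxτ, ← integral_const_mul]
  refine norm_integral_le_of_norm_le
    (((hC τ hτ).1.mono_set (Ioc_subset_Ioc_left hpx)).const_mul K) ?_
  filter_upwards [ae_restrict_mem measurableSet_Ioc] with s hs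
  exact norm_kernel_smul_le hSK hs.2 _

theorem SingularLp.exists_weighted_bound (hη0 : 0 < η) (hη1 : η < 1) (hq : 1 / η < q)
    (hγ0 : 0 ≤ γ) (hγ1 : γ < 1) (hSK : ∀ u, ‖S u‖ ≤ K) (hg : SingularLp q γ p t g) :
    ∃ C : ℝ, ∀ τ ∈ Ioc p t,
      (τ - p) ^ (1 - η) * ‖∫ s in p..τ, (τ - s) ^ (η - 1) • S (τ - s) (g s)‖ ≤ C := by
  obtain ⟨C, hC0, hC⟩ := hg.exists_kernel_bound hη0 hη1 hq hγ0 hγ1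
  have hK0 : 0 ≤ K := (norm_nonneg _).trans (hSK 0)
  have hq1 : 1 < q := lt_of_le_of_lt (by rw [le_div_iff₀ hη0]; linarith) hq
  have hq2 : 1 / q < 1 := by rw [div_lt_one (by linarith)]; exact hq1
  refine ⟨K * (C * (t - p) ^ (1 - 1 / q) + C * (t - p) ^ (1 - γ)), fun τ hτ => ?_⟩
  have hL : 0 < τ - p := by linarith [hτ.1]
  have hLt : τ - p ≤ t - p := by linarith [hτ.2]
  calc _ ≤ (τ - p) ^ (1 - η) * (K * (C * (τ - p) ^ (η - 1 / q) + C * (τ - p) ^ (η - γ))) := by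
        gcongr
        refine (hg.norm_integral_kernel_le hη0 hη1 hq hγ0 hγ1 hSK hτ le_rfl hτ.1.le).trans ?_
        gcongr
        exact (hC τ hτ).2.1
    _ = K * (C * ((τ - p) ^ (1 - η) * (τ - p) ^ (η - 1 / q)) +
          C * ((τ - p) ^ (1 - η) * (τ - p) ^ (η - γ))) := by ring
    _ = K * (C * (τ - p) ^ (1 - 1 / q) + C * (τ - p) ^ (1 - γ)) := by
        rw [← Real.rpow_add hL, ← Real.rpow_add hL]
        congr 4 <;> ring
    _ ≤ _ := by
        have h1 : 0 ≤ 1 - 1 / q := by linarith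
        have h2 : 0 ≤ 1 - γ := by linarith
        gcongr

/-- The convolution is continuous: it is locally uniformly approximated by the convolutions in
which the singular part `s > τ - ε` of the kernel is cut off. -/
theorem SingularLp.continuousOn_convolution (hη0 : 0 < η) (hη1 : η < 1) (hq : 1 / η < q)
    (hγ0 : 0 ≤ γ) (hγ1 : γ < 1) (hS : Continuous (fun r : ℝ × Z => S r.1 r.2))
    (hSK : ∀ u, ‖S u‖ ≤ K) (hg : SingularLp q γ p t g) :
    ContinuousOn (fun τ => ∫ s in p..τ, (τ - s) ^ (η - 1) • S (τ - s) (g s)) (Ioc p t) := by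
  obtain ⟨C, hC0, hC⟩ := hg.exists_kernel_bound hη0 hη1 hq hγ0 hγ1
  have hK0 : 0 ≤ K := (norm_nonneg _).trans (hSK 0)
  have hηq : 0 < η - 1 / q := by
    have hq0 : 0 < q := lt_trans (by positivity) hq
    rw [div_lt_iff₀ hη0] at hq; rw [sub_pos, div_lt_iff₀ hq0]; linarith
  intro τ₀ hτ₀
  set ρ := (τ₀ - p) / 2 with hρ
  have hρ0 : 0 < ρ := by have := hτ₀.1; rw [hρ]; linarith
  have hgint := hg.integrableOn hη0 hη1 hq hγ1
  -- the tail vanishes uniformly near `τ₀`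
  have htail : Tendsto (fun ε : ℝ => K * (C * ε ^ (η - 1 / q) + C * (ρ / 2) ^ (-γ) * ε ^ η))
      (𝓝[>] 0) (𝓝 0) := by
    have hcont : ContinuousAt
        (fun ε : ℝ => K * (C * ε ^ (η - 1 / q) + C * (ρ / 2) ^ (-γ) * ε ^ η)) 0 :=
      (((continuousAt_id.rpow_const (Or.inr hηq.le)).const_mul _).add
        ((continuousAt_id.rpow_const (Or.inr hη0.le)).const_mul _)).const_mul _
    have := hcont.tendsto
    rw [Real.zero_rpow hηq.ne', Real.zero_rpow hη0.ne'] at this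
    simpa using this.mono_left nhdsWithin_le_nhds
  refine continuousWithinAt_of_locally_uniform_approx_of_continuousWithinAt hτ₀ fun u hu => ?_
  obtain ⟨δ, hδ, hδu⟩ := Metric.mem_uniformity_dist.1 hu
  obtain ⟨ε, hεδ, hε0, hερ⟩ : ∃ ε : ℝ,
      K * (C * ε ^ (η - 1 / q) + C * (ρ / 2) ^ (-γ) * ε ^ η) < δ ∧ 0 < ε ∧ ε < ρ / 2 := by
    have h1 := htail.eventually (gt_mem_nhds hδ)
    have h2 : ∀ᶠ ε : ℝ in 𝓝[>] 0, ε < ρ / 2 :=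
      nhdsWithin_le_nhds (gt_mem_nhds (by positivity))
    obtain ⟨ε, h⟩ := (h1.and (h2.and self_mem_nhdsWithin)).exists
    exact ⟨ε, h.1, h.2.2, h.2.1⟩
  refine ⟨Ioi (p + ρ) ∩ Ioc p t, inter_mem (nhdsWithin_le_nhds (Ioi_mem_nhds (by linarith)))
    self_mem_nhdsWithin, fun τ => ∫ s in Ioc p t,
      (Iic (τ - ε)).indicator (fun s => (τ - s) ^ (η - 1) • S (τ - s) (g s)) s, ?_, ?_⟩
  · refine continuousWithinAt_of_dominated
      (bound := fun s => K * (ε ^ (η - 1) * ‖g s‖)) ?_ ?_ ((hgint.norm.const_mul _).const_mul _) ?_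
    · exact Eventually.of_forall fun τ =>
        (aestronglyMeasurable_kernel_smul hS hg.aestronglyMeasurable τ).indicator measurableSet_Iic
    · refine Eventually.of_forall fun τ => Eventually.of_forall fun s => ?_
      by_cases hs : s ∈ Iic (τ - ε)
      · rw [indicator_of_mem hs]
        have hs' : ε ≤ τ - s := by have : s ≤ τ - ε := hs; linarith
        refine (norm_kernel_smul_le hSK (by linarith) _).trans ?_
        have := Real.rpow_le_rpow_of_nonpos hε0 hs' (by linarith : η - 1 ≤ 0)
        gcongr
      · rw [indicator_of_notMem hs, norm_zero]; positivity
    · have hne : ∀ᵐ s : ℝ, s ≠ τ₀ - ε := by simp [ae_iff]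
      filter_upwards [ae_restrict_of_ae hne] with s hs
      apply ContinuousAt.continuousWithinAt
      rcases lt_or_gt_of_ne hs with h | h
      · have hev : (fun τ => (τ - s) ^ (η - 1) • S (τ - s) (g s)) =ᶠ[𝓝 τ₀] fun τ =>
            (Iic (τ - ε)).indicator (fun s => (τ - s) ^ (η - 1) • S (τ - s) (g s)) s := by
          filter_upwards [lt_mem_nhds (by linarith : s + ε < τ₀)] with τ hτ
          rw [indicator_of_mem (by rw [mem_Iic]; linarith)]
        refine ContinuousAt.congr ?_ hev
        refine ContinuousAt.smul ?_ ?_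
        · exact (by fun_prop : ContinuousAt (fun τ : ℝ => τ - s) τ₀).rpow_const
            (Or.inl (by linarith))
        · exact (hS.comp (by fun_prop : Continuous fun τ : ℝ => (τ - s, g s))).continuousAt
      · have hev : (fun _ : ℝ => (0 : Z)) =ᶠ[𝓝 τ₀] fun τ =>
            (Iic (τ - ε)).indicator (fun s => (τ - s) ^ (η - 1) • S (τ - s) (g s)) s := by
          filter_upwards [gt_mem_nhds (by linarith : τ₀ < s + ε)] with τ hτ
          rw [indicator_of_notMem (by rw [mem_Iic]; linarith)]
        exact continuousAt_const.congr hev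
  · rintro τ ⟨hτρ, hτ⟩
    apply hδu
    have hτρ' : p + ρ < τ := hτρ
    have hInt := hg.intervalIntegrable_kernel hη0 hη1 hq hγ0 hγ1 hS hSK hτ
    have hsub1 : uIcc p (τ - ε) ⊆ uIcc p τ := by
      rw [uIcc_of_le (by linarith), uIcc_of_le hτ.1.le]; exact Icc_subset_Icc_right (by linarith)
    have hsub2 : uIcc (τ - ε) τ ⊆ uIcc p τ := by
      rw [uIcc_of_le (by linarith), uIcc_of_le hτ.1.le]; exact Icc_subset_Icc_left (by linarith)
    have hset : Ioc p t ∩ Iic (τ - ε) = Ioc p (τ - ε) := by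
      rw [Ioc_inter_Iic, min_eq_right (by linarith [hτ.2])]
    beta_reduce
    rw [setIntegral_indicator measurableSet_Iic, hset,
      ← intervalIntegral.integral_of_le (by linarith), dist_eq_norm,
      ← intervalIntegral.integral_add_adjacent_intervals (hInt.mono_set hsub1)
        (hInt.mono_set hsub2), add_sub_cancel_left]
    refine (hg.norm_integral_kernel_le hη0 hη1 hq hγ0 hγ1 hSK hτ (by linarith)
      (by linarith)).trans_lt (lt_of_le_of_lt ?_ hεδ)
    gcongr
    refine ((hC τ hτ).2.2 (τ - ε) (by linarith) (by linarith)).trans ?_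
    rw [sub_sub_cancel]
    have := Real.rpow_le_rpow_of_nonpos (by positivity : 0 < ρ / 2)
      (by linarith : ρ / 2 ≤ τ - ε - p) (by linarith : -γ ≤ 0)
    gcongr

end Convolution

/-! ### Singular Volterra equations -/

section Caratheodory

variable {α Z E : Type*} [MeasurableSpace α] {μ : Measure α} [NormedAddCommGroup Z]
  [NormedAddCommGroup E]

/-- Superposition with a Carathéodory function preserves strong measurability, without any
separability of the space. -/
theorem aestronglyMeasurable_superposition {h : α → Z → E} {z : α → Z}
    (hmeas : ∀ x, AEStronglyMeasurable (fun s => h s x) μ)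
    (hcont : ∀ᵐ s ∂μ, Continuous (h s)) (hz : AEStronglyMeasurable z μ) :
    AEStronglyMeasurable (fun s => h s (z s)) μ := by
  obtain ⟨z', hz', hzz'⟩ := hz
  have hsimple : ∀ f : SimpleFunc α Z, AEStronglyMeasurable (fun s => h s (f s)) μ := by
    intro f
    have e : (fun s => h s (f s)) =
        fun s => ∑ y ∈ f.range, (f ⁻¹' {y}).indicator (fun s => h s y) s := by
      ext s
      rw [Finset.sum_eq_single (f s)]
      · simp
      · intro y _ hy
        rw [indicator_of_notMem]
        simpa using hy.symm
      · intro hs; exact absurd (f.mem_range_self s) hs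
    rw [e]
    exact Finset.aestronglyMeasurable_fun_sum _ fun y _ =>
      (hmeas y).indicator (f.measurableSet_fiber y)
  have hlim : AEStronglyMeasurable (fun s => h s (z' s)) μ := by
    refine aestronglyMeasurable_of_tendsto_ae atTop (fun n => hsimple (hz'.approx n)) ?_
    filter_upwards [hcont] with s hs
    exact (hs.tendsto _).comp (hz'.tendsto_approx s)
  refine hlim.congr ?_
  filter_upwards [hzz'] with s hs
  rw [hs]

end Caratheodory

theorem exp_neg_le_rpow {δ u : ℝ} (hδ0 : 0 ≤ δ) (hδ1 : δ ≤ 1) (hu : 0 < u) :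
    Real.exp (-u) ≤ u ^ (-δ) := by
  rw [Real.rpow_def_of_pos hu]
  apply Real.exp_le_exp.2
  have := Real.log_le_self hu.le
  nlinarith

/-- The data of a singular Volterra equation on `(p, t]` with a Lipschitz nonlinearity `h` and
forcing term `F`, for a bounded and strongly continuous family `S` of operators. -/
structure VolterraData {Z : Type*} [NormedAddCommGroup Z] [NormedSpace ℝ Z]
    (η q γ p t K κ : ℝ) (S : ℝ → Z →L[ℝ] Z) (F : ℝ → Z) (h : ℝ → Z → Z) : Prop where
  eta_pos : 0 < η
  eta_lt : η < 1
  lt_q : 1 / η < q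
  le_gamma : 1 - η ≤ γ
  gamma_lt : γ < 1
  lt : p < t
  continuous_S : Continuous (fun r : ℝ × Z => S r.1 r.2)
  norm_S : ∀ u, ‖S u‖ ≤ K
  forcing : SingularLp q γ p t F
  measurable_h : ∀ x : Z, AEStronglyMeasurable (fun s => h s x) (volume.restrict (Ioc p t))
  kappa_nonneg : 0 ≤ κ
  lipschitz_h : ∀ s ∈ Ioc p t, ∀ x y, ‖h s x - h s y‖ ≤ κ * ‖x - y‖
  h_zero : SingularLp q γ p t (fun s => h s 0)

/-- The right-hand side of the singular Volterra equation. -/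
noncomputable def volterraMap {Z : Type*} [NormedAddCommGroup Z] [NormedSpace ℝ Z] (η p : ℝ)
    (S : ℝ → Z →L[ℝ] Z) (F : ℝ → Z) (h : ℝ → Z → Z) (x₀ : Z) (z : ℝ → Z) (τ : ℝ) : Z :=
  (τ - p) ^ (η - 1) • S (τ - p) x₀ +
    ∫ s in p..τ, (τ - s) ^ (η - 1) • S (τ - s) (F s + h s (z s))

/-- Strongly measurable functions on `(p, t]` with finite norm `sup (τ - p) ^ (1 - η) ‖z τ‖`. -/
structure WeightedBounded {Z : Type*} [NormedAddCommGroup Z] (η p t : ℝ) (z : ℝ → Z) : Prop where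
  aestronglyMeasurable : AEStronglyMeasurable z (volume.restrict (Ioc p t))
  bound : ∃ C : ℝ, ∀ s ∈ Ioc p t, (s - p) ^ (1 - η) * ‖z s‖ ≤ C

theorem WeightedBounded.integrableOn {Z : Type*} [NormedAddCommGroup Z] {η p t : ℝ} {z : ℝ → Z}
    (hη0 : 0 < η)
    (hz : WeightedBounded η p t z) : IntegrableOn z (Ioc p t) := by
  rcases le_total t p with h | h
  · simp [Ioc_eq_empty_of_le h]
  obtain ⟨C, hC⟩ := hz.bound
  have hi := (intervalIntegrable_iff_integrableOn_Ioc_of_le h).1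
    (intervalIntegrable_rpow_sub (by linarith : 1 - η < 1) p t)
  refine (hi.const_mul C).mono' hz.aestronglyMeasurable ?_
  filter_upwards [ae_restrict_mem measurableSet_Ioc] with s hs
  have h0 : 0 < s - p := by linarith [hs.1]
  rw [Real.rpow_neg h0.le, ← div_eq_mul_inv, le_div_iff₀ (by positivity), mul_comm]
  exact hC s hs

namespace VolterraData

variable {Z : Type*} [NormedAddCommGroup Z] [NormedSpace ℝ Z] {η q γ p t K κ : ℝ}
  {S : ℝ → Z →L[ℝ] Z} {F : ℝ → Z} {h : ℝ → Z → Z} {z y : ℝ → Z}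

theorem gamma_nonneg (V : VolterraData η q γ p t K κ S F h) : 0 ≤ γ := by
  linarith [V.le_gamma, V.eta_lt]

theorem K_nonneg (V : VolterraData η q γ p t K κ S F h) : 0 ≤ K :=
  (norm_nonneg _).trans (V.norm_S 0)

theorem aestronglyMeasurable_h (V : VolterraData η q γ p t K κ S F h)
    (hz : AEStronglyMeasurable z (volume.restrict (Ioc p t))) :
    AEStronglyMeasurable (fun s => h s (z s)) (volume.restrict (Ioc p t)) := by
  refine aestronglyMeasurable_superposition V.measurable_h ?_ hz
  filter_upwards [ae_restrict_mem measurableSet_Ioc] with s hs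
  have : LipschitzWith (Real.toNNReal κ) (h s) := LipschitzWith.of_dist_le_mul fun x y => by
    rw [dist_eq_norm, dist_eq_norm, Real.coe_toNNReal _ V.kappa_nonneg]
    exact V.lipschitz_h s hs x y
  exact this.continuous

theorem singularLp_integrand (V : VolterraData η q γ p t K κ S F h)
    (hz : WeightedBounded η p t z) : SingularLp q γ p t (fun s => F s + h s (z s)) := by
  obtain ⟨C, hC⟩ := hz.bound
  have hC0 : 0 ≤ C := (mul_nonneg (Real.rpow_nonneg (by linarith [V.lt]) _)
    (norm_nonneg _)).trans (hC t ⟨V.lt, le_rfl⟩)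
  have h1 : SingularLp q γ p t (fun s => h s (z s) - h s 0) := by
    refine SingularLp.of_norm_le (β := 1 - η) (C := κ * C) V.le_gamma
      ((V.aestronglyMeasurable_h hz.aestronglyMeasurable).sub V.h_zero.aestronglyMeasurable)
      (mul_nonneg V.kappa_nonneg hC0) fun s hs => ?_
    have hs0 : 0 < s - p := by linarith [hs.1]
    refine (V.lipschitz_h s hs _ _).trans ?_
    rw [sub_zero, mul_assoc, Real.rpow_neg hs0.le, ← div_eq_mul_inv]
    have := V.kappa_nonneg
    gcongr
    rw [le_div_iff₀ (by positivity), mul_comm]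
    exact hC s hs
  have h2 := V.forcing.add (h1.add V.h_zero)
  simpa using h2

theorem continuousOn_volterraMap (V : VolterraData η q γ p t K κ S F h)
    (hz : WeightedBounded η p t z) (x₀ : Z) :
    ContinuousOn (volterraMap η p S F h x₀ z) (Ioc p t) := by
  refine ContinuousOn.add (ContinuousOn.smul ?_ ?_)
    ((V.singularLp_integrand hz).continuousOn_convolution V.eta_pos V.eta_lt V.lt_q
      V.gamma_nonneg V.gamma_lt V.continuous_S V.norm_S)
  · exact ContinuousOn.rpow_const (by fun_prop) fun τ hτ => Or.inl (by linarith [hτ.1])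
  · exact (V.continuous_S.comp (by fun_prop : Continuous fun τ : ℝ => (τ - p, x₀))).continuousOn

theorem exists_bound_volterraMap (V : VolterraData η q γ p t K κ S F h)
    (hz : WeightedBounded η p t z) (x₀ : Z) :
    ∃ C : ℝ, ∀ τ ∈ Ioc p t, (τ - p) ^ (1 - η) * ‖volterraMap η p S F h x₀ z τ‖ ≤ C := by
  obtain ⟨C, hC⟩ := (V.singularLp_integrand hz).exists_weighted_bound V.eta_pos V.eta_lt V.lt_q
      V.gamma_nonneg V.gamma_lt V.norm_S
  refine ⟨K * ‖x₀‖ + C, fun τ hτ => ?_⟩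
  have h0 : 0 < τ - p := by linarith [hτ.1]
  have e : (τ - p) ^ (1 - η) * (τ - p) ^ (η - 1) = 1 := by
    rw [← Real.rpow_add h0]; simp
  calc _ ≤ (τ - p) ^ (1 - η) * (‖(τ - p) ^ (η - 1) • S (τ - p) x₀‖ +
        ‖∫ s in p..τ, (τ - s) ^ (η - 1) • S (τ - s) (F s + h s (z s))‖) := by
        gcongr; exact norm_add_le _ _
    _ = ‖S (τ - p) x₀‖ + (τ - p) ^ (1 - η) *
          ‖∫ s in p..τ, (τ - s) ^ (η - 1) • S (τ - s) (F s + h s (z s))‖ := by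
        rw [mul_add, norm_smul, Real.norm_of_nonneg (by positivity), ← mul_assoc, e, one_mul]
    _ ≤ _ := add_le_add ((S _).le_of_opNorm_le (V.norm_S _) _) (hC τ hτ)

/-- For a large exponential weight (of Bielecki type) the Volterra map is a contraction. The bound
`exp (-u) ≤ u ^ (-η / 2)` trades the exponential for a factor `lam ^ (-η / 2)` at the price of
half of the integrability margin of the kernel. -/
theorem exists_contraction (V : VolterraData η q γ p t K κ S F h) :
    ∃ lam : ℝ, ∀ (x₀ : Z) (z y : ℝ → Z), WeightedBounded η p t z → WeightedBounded η p t y →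
      ∀ D : ℝ, 0 ≤ D →
        (∀ s ∈ Ioc p t, Real.exp (-lam * (s - p)) * (s - p) ^ (1 - η) * ‖z s - y s‖ ≤ D) →
        ∀ τ ∈ Ioc p t, Real.exp (-lam * (τ - p)) * (τ - p) ^ (1 - η) *
          ‖volterraMap η p S F h x₀ z τ - volterraMap η p S F h x₀ y τ‖ ≤ 1 / 2 * D := by
  have hη0 := V.eta_pos
  have hη1 := V.eta_lt
  have hK := V.K_nonneg
  have hκ := V.kappa_nonneg
  set E : ℝ := 2 ^ (1 - η / 2) / (1 - (1 - η)) + 2 ^ (1 - η) / (1 - (1 - η / 2)) with hE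
  have hE0 : 0 ≤ E := by
    have h1 : 0 < 1 - (1 - η) := by linarith
    have h2 : 0 < 1 - (1 - η / 2) := by linarith
    positivity
  have hlim : Tendsto (fun lam : ℝ => K * κ * E * (t - p) ^ (η / 2) * lam ^ (-(η / 2)))
      atTop (𝓝 0) := by
    have := (tendsto_rpow_neg_atTop (by linarith : 0 < η / 2)).const_mul
      (K * κ * E * (t - p) ^ (η / 2))
    rwa [mul_zero] at this
  obtain ⟨lam, hlam, hlam0⟩ := ((hlim.eventually (gt_mem_nhds (by norm_num : (0 : ℝ) < 1 / 2))).and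
    (eventually_gt_atTop 0)).exists
  refine ⟨lam, fun x₀ z y hz hy D hD hzy τ hτ => ?_⟩
  have hIz := (V.singularLp_integrand hz).intervalIntegrable_kernel hη0 hη1 V.lt_q
    V.gamma_nonneg V.gamma_lt V.continuous_S V.norm_S hτ
  have hIy := (V.singularLp_integrand hy).intervalIntegrable_kernel hη0 hη1 V.lt_q
    V.gamma_nonneg V.gamma_lt V.continuous_S V.norm_S hτ
  have hL : 0 < τ - p := by linarith [hτ.1]
  have ediff : volterraMap η p S F h x₀ z τ - volterraMap η p S F h x₀ y τ =
      ∫ s in Ioc p τ, (τ - s) ^ (η - 1) • S (τ - s) (h s (z s) - h s (y s)) := by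
    rw [volterraMap, volterraMap, add_sub_add_left_eq_sub, ← intervalIntegral.integral_sub hIz hIy,
      intervalIntegral.integral_of_le hτ.1.le]
    congr 1; ext s
    rw [← smul_sub, ← map_sub]; congr 2; abel
  obtain ⟨hBi, hBle⟩ := beta_integral_le (α := 1 - η / 2) (β := 1 - η) (by linarith)
    (by linarith) (by linarith) (by linarith) hτ.1
  set c : ℝ := K * κ * D * Real.exp (lam * (τ - p)) * lam ^ (-(η / 2)) with hc
  have hc0 : 0 ≤ c := by positivity
  have hnorm : ‖∫ s in Ioc p τ, (τ - s) ^ (η - 1) • S (τ - s) (h s (z s) - h s (y s))‖ ≤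
      c * ∫ s in Ioc p τ, (τ - s) ^ (-(1 - η / 2)) * (s - p) ^ (-(1 - η)) := by
    rw [← integral_const_mul]
    refine norm_integral_le_of_norm_le (hBi.const_mul c) ?_
    rw [← restrict_Ioo_eq_restrict_Ioc]
    filter_upwards [ae_restrict_mem measurableSet_Ioo] with s hs
    have hs' : s ∈ Ioc p t := ⟨hs.1, hs.2.le.trans hτ.2⟩
    have h1 : 0 < τ - s := by linarith [hs.2]
    have h2 : 0 < s - p := by linarith [hs.1]
    have hz1 : ‖z s - y s‖ ≤ D * (Real.exp (lam * (s - p)) * (s - p) ^ (-(1 - η))) := by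
      rw [← neg_neg (lam * (s - p)), Real.exp_neg, Real.rpow_neg h2.le, ← mul_inv,
        ← div_eq_mul_inv, le_div_iff₀ (by positivity), mul_comm, ← neg_mul]
      exact hzy s hs'
    have hexp : Real.exp (lam * (s - p)) ≤
        Real.exp (lam * (τ - p)) * (lam ^ (-(η / 2)) * (τ - s) ^ (-(η / 2))) := by
      have := exp_neg_le_rpow (δ := η / 2) (by linarith) (by linarith)
        (mul_pos hlam0 h1)
      rw [Real.mul_rpow hlam0.le h1.le] at this
      calc _ = Real.exp (lam * (τ - p)) * Real.exp (-(lam * (τ - s))) := by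
            rw [← Real.exp_add]; congr 1; ring
        _ ≤ _ := by gcongr
    calc _ ≤ K * ((τ - s) ^ (η - 1) * ‖h s (z s) - h s (y s)‖) :=
          norm_kernel_smul_le V.norm_S hs.2.le _
      _ ≤ K * ((τ - s) ^ (η - 1) * (κ * (D * ((Real.exp (lam * (τ - p)) *
            (lam ^ (-(η / 2)) * (τ - s) ^ (-(η / 2)))) * (s - p) ^ (-(1 - η)))))) := by
          gcongr
          refine (V.lipschitz_h s hs' _ _).trans ?_
          gcongr
          exact hz1.trans (by gcongr)
      _ = c * (((τ - s) ^ (η - 1) * (τ - s) ^ (-(η / 2))) * (s - p) ^ (-(1 - η))) := by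
          rw [hc]; ring
      _ = _ := by
          rw [← Real.rpow_add h1]; congr 3; ring
  rw [ediff]
  have epow : (τ - p) ^ (1 - η) * (τ - p) ^ (1 - (1 - η / 2) - (1 - η)) = (τ - p) ^ (η / 2) := by
    rw [← Real.rpow_add hL]; congr 1; ring
  have eexp : Real.exp (-lam * (τ - p)) * Real.exp (lam * (τ - p)) = 1 := by
    rw [← Real.exp_add]; simp
  calc _ ≤ Real.exp (-lam * (τ - p)) * (τ - p) ^ (1 - η) *
        (c * (E * (τ - p) ^ (1 - (1 - η / 2) - (1 - η)))) := by
        gcongr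
        exact hnorm.trans (by gcongr)
    _ = (Real.exp (-lam * (τ - p)) * Real.exp (lam * (τ - p))) *
          (K * κ * E * ((τ - p) ^ (1 - η) * (τ - p) ^ (1 - (1 - η / 2) - (1 - η))) *
            lam ^ (-(η / 2))) * D := by rw [hc]; ring
    _ = (K * κ * E * (τ - p) ^ (η / 2) * lam ^ (-(η / 2))) * D := by rw [eexp, epow, one_mul]
    _ ≤ (K * κ * E * (t - p) ^ (η / 2) * lam ^ (-(η / 2))) * D := by
        have : τ - p ≤ t - p := by linarith [hτ.2]
        gcongr
    _ ≤ _ := by gcongr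

theorem eqOn_of_solution (V : VolterraData η q γ p t K κ S F h) {x₀ : Z}
    (hz : WeightedBounded η p t z) (hy : WeightedBounded η p t y)
    (ez : ∀ τ ∈ Ioc p t, z τ = volterraMap η p S F h x₀ z τ)
    (ey : ∀ τ ∈ Ioc p t, y τ = volterraMap η p S F h x₀ y τ) : EqOn z y (Ioc p t) := by
  obtain ⟨lam, hlam⟩ := V.exists_contraction
  obtain ⟨C, hC⟩ := hz.bound
  obtain ⟨C', hC'⟩ := hy.bound
  have hnn : ∀ s ∈ Ioc p t, 0 ≤ (s - p) ^ (1 - η) := fun s hs =>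
    Real.rpow_nonneg (by linarith [hs.1]) _
  have ht : t ∈ Ioc p t := ⟨V.lt, le_rfl⟩
  have hC0 : 0 ≤ C := (mul_nonneg (hnn t ht) (norm_nonneg _)).trans (hC t ht)
  have hC0' : 0 ≤ C' := (mul_nonneg (hnn t ht) (norm_nonneg _)).trans (hC' t ht)
  set B : ℝ := Real.exp (|lam| * (t - p)) * (C + C') with hB
  have hB0 : 0 ≤ B := by positivity
  have hiter : ∀ n : ℕ, ∀ s ∈ Ioc p t,
      Real.exp (-lam * (s - p)) * (s - p) ^ (1 - η) * ‖z s - y s‖ ≤ (1 / 2) ^ n * B := by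
    intro n
    induction n with
    | zero =>
      intro s hs
      have h1 : Real.exp (-lam * (s - p)) ≤ Real.exp (|lam| * (t - p)) := by
        apply Real.exp_le_exp.2
        have h2 : -lam ≤ |lam| := neg_le_abs lam
        have h3 : 0 ≤ s - p := by linarith [hs.1]
        exact (mul_le_mul_of_nonneg_right h2 h3).trans
          (mul_le_mul_of_nonneg_left (by linarith [hs.2]) (abs_nonneg _))
      have h2 := hnn s hs
      rw [pow_zero, one_mul, hB, mul_assoc]
      gcongr
      calc _ ≤ (s - p) ^ (1 - η) * (‖z s‖ + ‖y s‖) := by gcongr; exact norm_sub_le _ _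
        _ ≤ _ := by rw [mul_add]; exact add_le_add (hC s hs) (hC' s hs)
    | succ n ih =>
      intro s hs
      rw [ez s hs, ey s hs, pow_succ', mul_assoc (1 / 2)]
      exact hlam x₀ z y hz hy _ (by positivity) ih s hs
  intro s hs
  have hlim : Tendsto (fun n : ℕ => (1 / 2 : ℝ) ^ n * B) atTop (𝓝 0) := by
    have := (tendsto_pow_atTop_nhds_zero_of_lt_one (by norm_num : (0 : ℝ) ≤ 1 / 2)
      (by norm_num)).mul_const B
    rwa [zero_mul] at this
  have hle := ge_of_tendsto' hlim fun n => hiter n s hs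
  have hpos : 0 < Real.exp (-lam * (s - p)) * (s - p) ^ (1 - η) :=
    mul_pos (Real.exp_pos _) (Real.rpow_pos_of_pos (by linarith [hs.1]) _)
  have h0 : ‖z s - y s‖ ≤ 0 := by
    by_contra hcon
    exact absurd hle (not_le.2 (mul_pos hpos (not_le.1 hcon)))
  exact sub_eq_zero.1 (norm_le_zero_iff.1 h0)

/-- The fixed point is found among the bounded continuous functions on `(p, t]`, which represent
the functions `z` through the weight `exp (-lam (s - p)) (s - p) ^ (1 - η)`. -/
theorem exists_solution [CompleteSpace Z] (V : VolterraData η q γ p t K κ S F h) (x₀ : Z) :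
    ∃ z : ℝ → Z, ContinuousOn z (Ioc p t) ∧ WeightedBounded η p t z ∧
      ∀ τ ∈ Ioc p t, z τ = volterraMap η p S F h x₀ z τ := by
  obtain ⟨lam, hlam⟩ := V.exists_contraction
  set W : ℝ → ℝ := fun s => Real.exp (-lam * (s - p)) * (s - p) ^ (1 - η) with hW
  have hWpos : ∀ s ∈ Ioc p t, 0 < W s := fun s hs =>
    mul_pos (Real.exp_pos _) (Real.rpow_pos_of_pos (by linarith [hs.1]) _)
  have hWcont : ContinuousOn W (Ioc p t) := by
    refine ContinuousOn.mul (by fun_prop) (ContinuousOn.rpow_const (by fun_prop) ?_)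
    exact fun τ hτ => Or.inl (by linarith [hτ.1])
  classical
  let X := BoundedContinuousFunction (Ioc p t) Z
  let ext : X → ℝ → Z := fun v s => if hs : s ∈ Ioc p t then (W s)⁻¹ • v ⟨s, hs⟩ else 0
  have hext : ∀ (v : X) (s : ℝ) (hs : s ∈ Ioc p t), ext v s = (W s)⁻¹ • v ⟨s, hs⟩ :=
    fun v s hs => dif_pos hs
  have hextc : ∀ v : X, ContinuousOn (ext v) (Ioc p t) := by
    intro v
    rw [continuousOn_iff_continuous_domRestrict] at hWcont ⊢
    have e : (Ioc p t).domRestrict (ext v) = fun s => ((Ioc p t).domRestrict W s)⁻¹ • v s := by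
      funext s; exact hext v s s.2
    rw [e]
    exact (hWcont.inv₀ fun s => (hWpos s s.2).ne').smul v.continuous
  have hextw : ∀ v : X, WeightedBounded η p t (ext v) := by
    intro v
    refine ⟨(hextc v).aestronglyMeasurable measurableSet_Ioc,
      Real.exp (|lam| * (t - p)) * ‖v‖, fun s hs => ?_⟩
    have hs0 : 0 < s - p := by linarith [hs.1]
    have hp0 : 0 < (s - p) ^ (1 - η) := Real.rpow_pos_of_pos hs0 _
    rw [hext v s hs, norm_smul, norm_inv, Real.norm_of_nonneg (hWpos s hs).le, ← mul_assoc]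
    gcongr
    · rw [hW, mul_inv, mul_left_comm, mul_inv_cancel₀ hp0.ne', mul_one, ← Real.exp_neg]
      apply Real.exp_le_exp.2
      have h2 : lam ≤ |lam| := le_abs_self lam
      have h3 : s - p ≤ t - p := by linarith [hs.2]
      nlinarith [mul_le_mul_of_nonneg_right h2 hs0.le,
        mul_le_mul_of_nonneg_left h3 (abs_nonneg lam)]
    · exact v.norm_coe_le_norm _
  have hbd : ∀ v : X, ∃ C : ℝ, ∀ τ : Ioc p t,
      ‖W τ • volterraMap η p S F h x₀ (ext v) τ‖ ≤ C := by
    intro v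
    obtain ⟨C, hC⟩ := V.exists_bound_volterraMap (hextw v) x₀
    refine ⟨Real.exp (|lam| * (t - p)) * C, fun τ => ?_⟩
    have hs0 : 0 < (τ : ℝ) - p := by linarith [τ.2.1]
    have hp0 : 0 < ((τ : ℝ) - p) ^ (1 - η) := Real.rpow_pos_of_pos hs0 _
    rw [norm_smul, Real.norm_of_nonneg (hWpos τ τ.2).le, hW, mul_assoc]
    gcongr
    · exact neg_le_abs lam
    · exact τ.2.2
    · exact hC τ τ.2
  let Φ : X → X := fun v => BoundedContinuousFunction.ofNormedAddCommGroup
    (fun τ : Ioc p t => W τ • volterraMap η p S F h x₀ (ext v) τ)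
    (((continuousOn_iff_continuous_domRestrict.1 hWcont).smul
      (continuousOn_iff_continuous_domRestrict.1 (V.continuousOn_volterraMap (hextw v) x₀))))
    (hbd v).choose (hbd v).choose_spec
  have hΦ : ∀ v τ, Φ v τ = W τ • volterraMap η p S F h x₀ (ext v) τ := fun v τ => rfl
  have hcontr : ContractingWith (1 / 2) Φ := by
    refine ⟨by norm_num, LipschitzWith.of_dist_le_mul fun v w => ?_⟩
    rw [BoundedContinuousFunction.dist_le (by positivity)]
    intro τ
    rw [hΦ, hΦ, dist_eq_norm, ← smul_sub, norm_smul, Real.norm_of_nonneg (hWpos τ τ.2).le]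
    have := hlam x₀ (ext v) (ext w) (hextw v) (hextw w) (dist v w) dist_nonneg
      (fun s hs => by
        rw [hext v s hs, hext w s hs, ← smul_sub, norm_smul, norm_inv,
          Real.norm_of_nonneg (hWpos s hs).le, ← mul_assoc]
        change W s * (W s)⁻¹ * _ ≤ _
        rw [mul_inv_cancel₀ (hWpos s hs).ne', one_mul, ← dist_eq_norm]
        exact BoundedContinuousFunction.dist_coe_le_dist _) τ τ.2
    have e : ((1 / 2 : NNReal) : ℝ) = 1 / 2 := by norm_num
    rw [e]
    exact this
  have hfix := hcontr.fixedPoint_isFixedPt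
  set v := hcontr.fixedPoint
  refine ⟨ext v, hextc v, hextw v, fun τ hτ => ?_⟩
  rw [hext v τ hτ]
  nth_rewrite 1 [← hfix]
  rw [hΦ, smul_smul, inv_mul_cancel₀ (hWpos τ hτ).ne', one_smul]

end VolterraData

/-! ### The memory term and the succession of the intervals -/

section MemoryTerm

variable {Z : Type*} [NormedAddCommGroup Z] [NormedSpace ℝ Z] {η q γ p t c d : ℝ} {w : ℝ → Z}

theorem SingularLp.const_smul {g : ℝ → Z} (hg : SingularLp q γ p t g) (e : ℝ) :
    SingularLp q γ p t (fun s => e • g s) := by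
  obtain ⟨l, C, hl, hC, hb⟩ := hg.bound
  refine ⟨hg.aestronglyMeasurable.const_smul e, fun s => e * l s, |e| * C, hl.const_mul e,
    by positivity, ?_⟩
  filter_upwards [hb] with s hs
  rw [norm_smul, Real.norm_eq_abs, abs_mul, mul_assoc, ← mul_add]
  gcongr

theorem aestronglyMeasurable_history (hcd : c ≤ d)
    (hw : AEStronglyMeasurable w (volume.restrict (Ioc c d))) :
    AEStronglyMeasurable (fun s => ∫ σ in c..d, (1 / (s - σ) ^ (1 + η)) • w σ)
      (volume.restrict (Ioc p t)) := by
  simp_rw [intervalIntegral.integral_of_le hcd]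
  refine AEStronglyMeasurable.integral_prod_right'
    (f := fun x : ℝ × ℝ => (1 / (x.1 - x.2) ^ (1 + η)) • w x.2) ?_
  refine AEStronglyMeasurable.smul ?_ hw.comp_snd
  apply Measurable.aestronglyMeasurable; fun_prop

theorem singularLp_history_of_lt (hη0 : 0 < η) (hγ0 : 0 ≤ γ) (hcd : c ≤ d) (hdp : d < p)
    (hw : IntegrableOn w (Ioc c d)) :
    SingularLp q γ p t (fun s => ∫ σ in c..d, (1 / (s - σ) ^ (1 + η)) • w σ) := by
  have hdp' : 0 < p - d := by linarith
  refine SingularLp.of_norm_le (β := 0) (C := 1 / (p - d) ^ (1 + η) * ∫ σ in Ioc c d, ‖w σ‖) hγ0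
    (aestronglyMeasurable_history hcd hw.aestronglyMeasurable)
    (mul_nonneg (by positivity) (integral_nonneg fun _ => norm_nonneg _)) fun s hs => ?_
  rw [neg_zero, Real.rpow_zero, mul_one, intervalIntegral.integral_of_le hcd,
    ← integral_const_mul]
  refine norm_integral_le_of_norm_le (hw.norm.const_mul _) ?_
  filter_upwards [ae_restrict_mem measurableSet_Ioc] with σ hσ
  have h1 : p - d ≤ s - σ := by linarith [hσ.2, hs.1]
  have h2 : 0 < s - σ := by linarith
  rw [norm_smul, Real.norm_of_nonneg (by positivity)]
  gcongr

/-- A bounded history up to the time `p` produces the singularity `(s - p) ^ (-η)`. -/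
theorem singularLp_history_of_bounded {C : ℝ} (hη0 : 0 < η) (hηγ : η ≤ γ) (hcd : c ≤ d)
    (hdp : d ≤ p) (hw : AEStronglyMeasurable w (volume.restrict (Ioc c d)))
    (hC0 : 0 ≤ C) (hC : ∀ σ ∈ Ioc c d, ‖w σ‖ ≤ C) :
    SingularLp q γ p t (fun s => ∫ σ in c..d, (1 / (s - σ) ^ (1 + η)) • w σ) := by
  refine SingularLp.of_norm_le (β := η) (C := C / η) hηγ (aestronglyMeasurable_history hcd hw)
    (by positivity) fun s hs => ?_
  have hsd : 0 < s - d := by linarith [hs.1]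
  have hcont : ContinuousOn (fun σ : ℝ => C * (s - σ) ^ (-(1 + η))) (uIcc c d) := by
    rw [uIcc_of_le hcd]
    refine ContinuousOn.mul continuousOn_const (ContinuousOn.rpow_const (by fun_prop) ?_)
    exact fun σ hσ => Or.inl (by linarith [hσ.2])
  have hval : ∫ σ in c..d, C * (s - σ) ^ (-(1 + η)) =
      C / η * ((s - d) ^ (-η) - (s - c) ^ (-η)) := by
    rw [intervalIntegral.integral_const_mul,
      intervalIntegral.integral_comp_sub_left (fun u => u ^ (-(1 + η))) s,
      integral_rpow (Or.inr ⟨by linarith, ?_⟩)]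
    · have e : -(1 + η) + 1 = -η := by ring
      rw [e]; field_simp; ring
    · rw [uIcc_of_le (by linarith)]
      exact fun h0 => by linarith [h0.1]
  calc _ ≤ ∫ σ in c..d, C * (s - σ) ^ (-(1 + η)) := by
        refine intervalIntegral.norm_integral_le_of_norm_le hcd
          (Eventually.of_forall fun σ hσ => ?_) hcont.intervalIntegrable
        have h2 : 0 < s - σ := by linarith [hσ.2]
        rw [norm_smul, Real.norm_of_nonneg (by positivity), Real.rpow_neg h2.le, mul_comm,
          one_div]
        gcongr
        exact hC σ hσ
    _ ≤ C / η * (s - p) ^ (-η) := by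
        rw [hval]
        have h1 : 0 ≤ (s - c) ^ (-η) := Real.rpow_nonneg (by linarith) _
        have h2 : (s - d) ^ (-η) ≤ (s - p) ^ (-η) :=
          Real.rpow_le_rpow_of_nonpos (by linarith [hs.1]) (by linarith) (by linarith)
        gcongr
        linarith

end MemoryTerm

namespace IsImpulseTimes

variable {m : ℕ} {a : ℝ} {p t : ℕ → ℝ}

theorem t_le_p (H : IsImpulseTimes m a p t) {k : ℕ} (hk : k ≤ m) : t (k + 1) ≤ p (k + 1) := by
  rcases hk.lt_or_eq with h | rfl
  · exact (H.t_lt_p (k + 1) (by omega) h).le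
  · rw [H.t_last, H.p_last]

theorem p_le_p (H : IsImpulseTimes m a p t) {k l : ℕ} (hkl : k ≤ l) (hl : l ≤ m + 1) :
    p k ≤ p l := by
  induction l, hkl using Nat.le_induction with
  | base => exact le_rfl
  | succ l _ ih =>
    exact (ih (by omega)).trans ((H.p_lt_t l (by omega)).le.trans (H.t_le_p (by omega)))

theorem p_nonneg (H : IsImpulseTimes m a p t) {k : ℕ} (hk : k ≤ m + 1) : 0 ≤ p k := by
  rw [← H.p_zero]; exact H.p_le_p (Nat.zero_le k) hk

theorem t_le_a (H : IsImpulseTimes m a p t) {k : ℕ} (hk : k ≤ m) : t (k + 1) ≤ a := by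
  rw [← H.p_last]; exact (H.t_le_p hk).trans (H.p_le_p (by omega) le_rfl)

theorem Ioc_subset (H : IsImpulseTimes m a p t) {k : ℕ} (hk : k ≤ m) :
    Ioc (p k) (t (k + 1)) ⊆ Icc 0 a := fun _ hs =>
  ⟨(H.p_nonneg (by omega)).trans hs.1.le, hs.2.trans (H.t_le_a hk)⟩

theorem exists_mem (H : IsImpulseTimes m a p t) {τ : ℝ} (hτ : τ ∈ Ioc 0 a) :
    ∃ r, r ≤ m ∧ (τ ∈ Ioc (p r) (t (r + 1)) ∨ 1 ≤ r ∧ τ ∈ Ioc (t r) (p r)) := by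
  have key : ∀ n, n ≤ m → τ ≤ t (n + 1) →
      ∃ r, r ≤ m ∧ (τ ∈ Ioc (p r) (t (r + 1)) ∨ 1 ≤ r ∧ τ ∈ Ioc (t r) (p r)) := by
    intro n
    induction n with
    | zero => exact fun _ h => ⟨0, Nat.zero_le m, Or.inl ⟨by rw [H.p_zero]; exact hτ.1, h⟩⟩
    | succ n ih =>
      intro hn h
      rcases le_or_gt τ (t (n + 1)) with h1 | h1
      · exact ih (by omega) h1
      rcases le_or_gt τ (p (n + 1)) with h2 | h2
      · exact ⟨n + 1, hn, Or.inr ⟨by omega, h1, h2⟩⟩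
      · exact ⟨n + 1, hn, Or.inl ⟨h2, h⟩⟩
  exact key m le_rfl (by rw [H.t_last]; exact hτ.2)

end IsImpulseTimes

theorem startValue_congr {Z : Type*} {m : ℕ} {a : ℝ} {p t : ℕ → ℝ} {ψ : ℕ → ℝ → Z → Z}
    {z y : ℝ → Z} (hpt : IsImpulseTimes m a p t) {z₀ : Z} {r : ℕ} (hr : r ≤ m)
    (hzy : ∀ k, k < r → EqOn z y (Ioc (p k) (t (k + 1)))) :
    startValue p t ψ z₀ z r = startValue p t ψ z₀ y r := by
  unfold startValue
  split_ifs with h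
  · rfl
  · obtain ⟨k, rfl⟩ := Nat.exists_eq_succ_of_ne_zero h
    rw [hzy k (Nat.lt_succ_self k) ⟨hpt.p_lt_t k (by omega), le_rfl⟩]

theorem MemPC.weightedBounded {Z : Type*} [NormedAddCommGroup Z] {η a : ℝ} {m : ℕ}
    {p t : ℕ → ℝ} {z : ℝ → Z} (hpt : IsImpulseTimes m a p t) (hz : MemPC η m p t z) {r : ℕ}
    (hr : r ≤ m) : WeightedBounded η (p r) (t (r + 1)) z := by
  constructor
  · rw [← restrict_Ioo_eq_restrict_Ioc]
    exact (hz.continuousOn_left r hr).aestronglyMeasurable measurableSet_Ioo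
  · obtain ⟨C, hC⟩ := hz.bddAbove r hr
    exact ⟨C, fun s hs => hC ⟨s, ⟨hs.1, hs.2.trans (hpt.t_le_p hr)⟩, rfl⟩⟩

section Stages

variable {Z : Type*} [NormedAddCommGroup Z] [NormedSpace ℝ Z] {η q γ a : ℝ} {m : ℕ}
  {p t : ℕ → ℝ} {ψ : ℕ → ℝ → Z → Z} {z y : ℝ → Z}

theorem singularLp_memoryTerm (hpt : IsImpulseTimes m a p t) (hη0 : 0 < η) (hηγ : η ≤ γ)
    (hψ : ∀ r, 1 ≤ r → r ≤ m →
      ContinuousOn (fun x : ℝ × Z => ψ r x.1 x.2) (Icc (t r) (p r) ×ˢ univ))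
    {r : ℕ} (hr : r ≤ m) (hz : ∀ k, k < r → WeightedBounded η (p k) (t (k + 1)) z) :
    SingularLp q γ (p r) (t (r + 1)) (memoryTerm η p t ψ z r) := by
  refine SingularLp.const_smul (SingularLp.sum _ fun k hk => ?_) _
  have hkr : k < r := Finset.mem_range.1 hk
  have htp : t (k + 1) < p (k + 1) := hpt.t_lt_p (k + 1) (by omega) (by omega)
  have hpp : p (k + 1) ≤ p r := hpt.p_le_p (by omega) (by omega)
  have hc : ContinuousOn (fun σ => ψ (k + 1) σ (z (t (k + 1)))) (Icc (t (k + 1)) (p (k + 1))) :=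
    (hψ (k + 1) (by omega) (by omega)).comp (f := fun σ : ℝ => (σ, z (t (k + 1))))
      (by fun_prop) fun σ hσ => ⟨hσ, mem_univ _⟩
  obtain ⟨C, hC⟩ := isCompact_Icc.exists_bound_of_continuousOn hc
  refine SingularLp.add ?_ ?_
  · exact singularLp_history_of_lt hη0 (hη0.le.trans hηγ) (hpt.p_lt_t k (by omega)).le
      (htp.trans_le hpp) ((hz k hkr).integrableOn hη0)
  · exact singularLp_history_of_bounded hη0 hηγ htp.le hpp
      ((hc.mono Ioc_subset_Icc_self).aestronglyMeasurable measurableSet_Ioc)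
      ((norm_nonneg _).trans (hC _ (left_mem_Icc.2 htp.le)))
      fun σ hσ => hC σ (Ioc_subset_Icc_self hσ)

theorem memoryTerm_congr (hpt : IsImpulseTimes m a p t) {r : ℕ} (hr : r ≤ m)
    (hzy : ∀ k, k < r → EqOn z y (Ioc (p k) (t (k + 1)))) :
    memoryTerm η p t ψ z r = memoryTerm η p t ψ y r := by
  ext s
  unfold memoryTerm
  congr 1
  refine Finset.sum_congr rfl fun k hk => ?_
  have hkr : k < r := Finset.mem_range.1 hk
  have hpt' := hpt.p_lt_t k (by omega)
  congr 1
  · rw [intervalIntegral.integral_of_le hpt'.le, intervalIntegral.integral_of_le hpt'.le]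
    refine setIntegral_congr_fun measurableSet_Ioc fun σ hσ => ?_
    simp only [hzy k hkr hσ]
  · rw [hzy k hkr ⟨hpt', le_rfl⟩]

theorem evolution_eq_volterraMap (hpt : IsImpulseTimes m a p t) {T S : ℝ → Z →L[ℝ] Z}
    (hTS : ∀ τ ∈ Icc 0 a, ∀ x, fracOp η T τ x = S τ x) {f g : ℝ → Z} {h : ℝ → Z → Z} {x₀ : Z}
    {r : ℕ} (hr : r ≤ m) {τ : ℝ} (hτ : τ ∈ Ioc (p r) (t (r + 1))) :
    (τ - p r) ^ (η - 1) • fracOp η T (τ - p r) x₀ +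
      ∫ s in (p r)..τ, (τ - s) ^ (η - 1) • fracOp η T (τ - s) (f s + h s (z s) + g s) =
    volterraMap η (p r) S (fun s => f s + g s) h x₀ z τ := by
  have h0 := hpt.p_nonneg (k := r) (by omega)
  have ha := (hpt.Ioc_subset hr hτ).2
  rw [volterraMap, hTS _ ⟨by linarith [hτ.1], by linarith⟩]
  congr 1
  rw [intervalIntegral.integral_of_le hτ.1.le, intervalIntegral.integral_of_le hτ.1.le]
  refine setIntegral_congr_fun measurableSet_Ioc fun s hs => ?_
  rw [hTS _ ⟨by linarith [hs.2], by linarith [hs.1]⟩, add_right_comm]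

/-- The function `z` solves the system on `(t r, t (r + 1)]`, given its own history. -/
structure IsStageSolution (η : ℝ) (p t : ℕ → ℝ) (T : ℝ → Z →L[ℝ] Z) (f : ℝ → Z)
    (h : ℝ → Z → Z) (ψ : ℕ → ℝ → Z → Z) (z₀ : Z) (z : ℝ → Z) (r : ℕ) : Prop where
  continuousOn : ContinuousOn z (Ioc (p r) (t (r + 1)))
  weightedBounded : WeightedBounded η (p r) (t (r + 1)) z
  eq_evolution : ∀ τ ∈ Ioc (p r) (t (r + 1)),
    z τ = (τ - p r) ^ (η - 1) • fracOp η T (τ - p r) (startValue p t ψ z₀ z r) +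
      ∫ s in (p r)..τ, (τ - s) ^ (η - 1) •
        fracOp η T (τ - s) (f s + h s (z s) + memoryTerm η p t ψ z r s)
  eq_impulse : 1 ≤ r → ∀ τ ∈ Ioc (t r) (p r), z τ = ψ r τ (z (t r))

theorem IsStageSolution.congr (hpt : IsImpulseTimes m a p t) {T : ℝ → Z →L[ℝ] Z} {f : ℝ → Z}
    {h : ℝ → Z → Z} {z₀ : Z} {r : ℕ} (hr : r ≤ m)
    (hz : IsStageSolution η p t T f h ψ z₀ z r)
    (hzy : ∀ k, k ≤ r → EqOn z y (Ioc (p k) (t (k + 1))))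
    (hzy' : 1 ≤ r → EqOn z y (Ioc (t r) (p r))) : IsStageSolution η p t T f h ψ z₀ y r := by
  have hrr := hzy r le_rfl
  refine ⟨hz.continuousOn.congr fun s hs => (hrr hs).symm, ⟨?_, ?_⟩, fun τ hτ => ?_,
    fun h1 τ hτ => ?_⟩
  · refine hz.weightedBounded.aestronglyMeasurable.congr ?_
    filter_upwards [ae_restrict_mem measurableSet_Ioc] with s hs using hrr hs
  · obtain ⟨C, hC⟩ := hz.weightedBounded.bound
    exact ⟨C, fun s hs => by rw [← hrr hs]; exact hC s hs⟩
  · rw [← hrr hτ, ← memoryTerm_congr hpt hr fun k hk => hzy k hk.le,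
      ← startValue_congr hpt hr fun k hk => hzy k hk.le, hz.eq_evolution τ hτ]
    congr 1
    rw [intervalIntegral.integral_of_le hτ.1.le, intervalIntegral.integral_of_le hτ.1.le]
    refine setIntegral_congr_fun measurableSet_Ioc fun s hs => ?_
    simp only [hrr ⟨hs.1, hs.2.trans hτ.2⟩]
  · obtain ⟨k, rfl⟩ := Nat.exists_eq_succ_of_ne_zero (by omega : r ≠ 0)
    rw [← hzy' h1 hτ, ← hzy k (by omega) ⟨hpt.p_lt_t k (by omega), le_rfl⟩]
    exact hz.eq_impulse h1 τ hτ

theorem tendsto_left_of_continuousOn_Ioc {E : Type*} [TopologicalSpace E] {g : ℝ → E} {c d : ℝ}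
    (hcd : c < d) (hg : ContinuousOn g (Ioc c d)) : Tendsto g (𝓝[<] d) (𝓝 (g d)) := by
  rw [← nhdsWithin_Ioo_eq_nhdsLT hcd]
  exact (hg d ⟨hcd, le_rfl⟩).mono_left (nhdsWithin_mono _ Ioo_subset_Ioc_self)

/-- Solutions on all the successive intervals make up a mild solution. -/
theorem isMildSolution_of_stages (hpt : IsImpulseTimes m a p t) (hη1 : η < 1)
    {T : ℝ → Z →L[ℝ] Z} {f : ℝ → Z} {h : ℝ → Z → Z} {z₀ : Z}
    (hψ : ∀ r, 1 ≤ r → r ≤ m →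
      ContinuousOn (fun x : ℝ × Z => ψ r x.1 x.2) (Icc (t r) (p r) ×ˢ univ))
    (hz : ∀ r, r ≤ m → IsStageSolution η p t T f h ψ z₀ z r) :
    IsMildSolution η m p t T f h ψ z₀ z := by
  have hψz : ∀ r, 1 ≤ r → r ≤ m →
      ContinuousOn (fun σ => ψ r σ (z (t r))) (Icc (t r) (p r)) := fun r h1 hr =>
    (hψ r h1 hr).comp (f := fun σ : ℝ => (σ, z (t r))) (by fun_prop) fun σ hσ => ⟨hσ, mem_univ _⟩
  have hzc : ∀ r, 1 ≤ r → r ≤ m → ContinuousOn z (Ioc (t r) (p r)) := fun r h1 hr =>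
    ((hψz r h1 hr).mono Ioc_subset_Icc_self).congr fun σ hσ => (hz r hr).eq_impulse h1 σ hσ
  refine ⟨⟨fun r hr => (hz r hr).continuousOn.mono Ioo_subset_Ioc_self,
    fun r h1 hr => (hzc r h1 hr).mono Ioo_subset_Ioc_self,
    fun r h1 hr => tendsto_left_of_continuousOn_Ioc (hpt.t_lt_p r h1 hr) (hzc r h1 hr),
    fun r h1 hr => ?_, fun r hr => ?_⟩, fun r hr => (hz r hr).eq_evolution,
    fun r h1 hr => (hz r hr).eq_impulse h1⟩
  · obtain ⟨k, rfl⟩ := Nat.exists_eq_succ_of_ne_zero (by omega : r ≠ 0)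
    exact tendsto_left_of_continuousOn_Ioc (hpt.p_lt_t k (by omega)) (hz k (by omega)).continuousOn
  · obtain ⟨C, hC⟩ := (hz r hr).weightedBounded.bound
    rcases hr.lt_or_eq with hrm | rfl
    · obtain ⟨D, hD⟩ := isCompact_Icc.exists_bound_of_continuousOn (hψz (r + 1) (by omega) hrm)
      refine ⟨max C ((p (r + 1) - p r) ^ (1 - η) * D), ?_⟩
      rintro _ ⟨s, hs, rfl⟩
      rcases le_or_gt s (t (r + 1)) with h1 | h1
      · exact (hC s ⟨hs.1, h1⟩).trans (le_max_left _ _)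
      · refine le_trans ?_ (le_max_right _ _)
        beta_reduce
        rw [(hz (r + 1) hrm).eq_impulse (by omega) s ⟨h1, hs.2⟩]
        have h2 := hD s ⟨h1.le, hs.2⟩
        have h3 : 0 ≤ s - p r := by linarith [hs.1]
        have h4 : 0 ≤ 1 - η := by linarith
        have h5 := hs.2
        gcongr
        exact Real.rpow_nonneg (by linarith) _
    · refine ⟨C, ?_⟩
      rintro _ ⟨s, hs, rfl⟩
      exact hC s ⟨hs.1, by rw [hpt.t_last, ← hpt.p_last]; exact hs.2⟩

theorem exists_isMildSolution [CompleteSpace Z] (hpt : IsImpulseTimes m a p t) (hη1 : η < 1)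
    {T S : ℝ → Z →L[ℝ] Z} {K κ : ℝ} (hTS : ∀ τ ∈ Icc 0 a, ∀ x, fracOp η T τ x = S τ x)
    {f : ℝ → Z} {h : ℝ → Z → Z} {z₀ : Z}
    (hψ : ∀ r, 1 ≤ r → r ≤ m →
      ContinuousOn (fun x : ℝ × Z => ψ r x.1 x.2) (Icc (t r) (p r) ×ˢ univ))
    (hV : ∀ r, r ≤ m → ∀ z : ℝ → Z, (∀ k, k < r → WeightedBounded η (p k) (t (k + 1)) z) →
      VolterraData η q γ (p r) (t (r + 1)) K κ S (fun s => f s + memoryTerm η p t ψ z r s) h) :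
    ∃ z : ℝ → Z, IsMildSolution η m p t T f h ψ z₀ z := by
  have key : ∀ n, n ≤ m + 1 → ∃ z : ℝ → Z, ∀ r, r < n → IsStageSolution η p t T f h ψ z₀ z r := by
    intro n
    induction n with
    | zero => exact fun _ => ⟨0, fun r hr => absurd hr (Nat.not_lt_zero r)⟩
    | succ n ih =>
      intro hn
      obtain ⟨z, hz⟩ := ih (by omega)
      have V := hV n (by omega) z fun k hk => (hz k hk).weightedBounded
      obtain ⟨w, hwc, hwb, hw⟩ := V.exists_solution (startValue p t ψ z₀ z n)
      -- prescribe the impulse on `(t n, p n]` and the Volterra solution after `p n`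
      set y : ℝ → Z := fun τ => if p n < τ then w τ else
        if 1 ≤ n ∧ t n < τ then ψ n τ (z (t n)) else z τ with hy
      have hyw : EqOn w y (Ioc (p n) (t (n + 1))) := fun τ hτ => (if_pos hτ.1).symm
      have hyz : ∀ τ, τ ≤ p n → (1 ≤ n → τ ≤ t n) → z τ = y τ := by
        intro τ h1 h2
        rw [hy]; beta_reduce
        rw [if_neg (not_lt.2 h1), if_neg fun h => not_lt.2 (h2 h.1) h.2]
      have ht_le : ∀ k, k < n → t (k + 1) ≤ t n := by
        intro k hk
        obtain ⟨l, rfl⟩ := Nat.exists_eq_succ_of_ne_zero (by omega : n ≠ 0)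
        rcases (by omega : k = l ∨ k + 1 ≤ l) with rfl | h
        · exact le_rfl
        · exact (hpt.t_le_p (by omega)).trans
            ((hpt.p_le_p h (by omega)).trans (hpt.p_lt_t l (by omega)).le)
      have hyz' : ∀ k, k < n → EqOn z y (Ioc (p k) (t (k + 1))) := fun k hk τ hτ =>
        hyz τ (hτ.2.trans ((hpt.t_le_p (by omega)).trans (hpt.p_le_p (by omega) (by omega))))
          fun _ => hτ.2.trans (ht_le k hk)
      refine ⟨y, fun r hr => ?_⟩
      rcases (by omega : r < n ∨ r = n) with hrn | rfl
      · refine (hz r hrn).congr hpt (by omega) (fun k hk => hyz' k (by omega)) fun h1 τ hτ => ?_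
        exact hyz τ (hτ.2.trans (hpt.p_le_p (by omega) (by omega)))
          fun _ => hτ.2.trans ((hpt.p_lt_t r (by omega)).le.trans (ht_le r hrn))
      · refine ⟨hwc.congr fun τ hτ => (hyw hτ).symm, ⟨?_, ?_⟩, fun τ hτ => ?_, fun h1 τ hτ => ?_⟩
        · refine hwb.aestronglyMeasurable.congr ?_
          filter_upwards [ae_restrict_mem measurableSet_Ioc] with s hs using hyw hs
        · obtain ⟨C, hC⟩ := hwb.bound
          exact ⟨C, fun s hs => by rw [← hyw hs]; exact hC s hs⟩
        · rw [← memoryTerm_congr hpt (by omega) hyz', ← startValue_congr hpt (by omega) hyz',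
            evolution_eq_volterraMap hpt hTS (by omega) hτ, ← hyw hτ, hw τ hτ, volterraMap,
            volterraMap]
          congr 1
          rw [intervalIntegral.integral_of_le hτ.1.le, intervalIntegral.integral_of_le hτ.1.le]
          refine setIntegral_congr_fun measurableSet_Ioc fun s hs => ?_
          simp only [hyw ⟨hs.1, hs.2.trans hτ.2⟩]
        · rw [← hyz (t r) (hpt.t_lt_p r h1 (by omega)).le fun _ => le_rfl]
          rw [hy]; beta_reduce
          rw [if_neg (not_lt.2 hτ.2), if_pos ⟨h1, hτ.1⟩]
  obtain ⟨z, hz⟩ := key (m + 1) le_rfl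
  exact ⟨z, isMildSolution_of_stages hpt hη1 hψ fun r hr => hz r (by omega)⟩

theorem IsMildSolution.eqOn (hpt : IsImpulseTimes m a p t)
    {T S : ℝ → Z →L[ℝ] Z} {K κ : ℝ} (hTS : ∀ τ ∈ Icc 0 a, ∀ x, fracOp η T τ x = S τ x)
    {f : ℝ → Z} {h : ℝ → Z → Z} {z₀ : Z}
    (hV : ∀ r, r ≤ m → ∀ z : ℝ → Z, (∀ k, k < r → WeightedBounded η (p k) (t (k + 1)) z) →
      VolterraData η q γ (p r) (t (r + 1)) K κ S (fun s => f s + memoryTerm η p t ψ z r s) h)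
    (hz : IsMildSolution η m p t T f h ψ z₀ z) (hy : IsMildSolution η m p t T f h ψ z₀ y) :
    EqOn z y (Ioc 0 a) := by
  have key : ∀ r, r ≤ m → EqOn z y (Ioc (p r) (t (r + 1))) := by
    intro r
    induction r using Nat.strong_induction_on with
    | _ r ih =>
      intro hr
      have ih' : ∀ k, k < r → EqOn z y (Ioc (p k) (t (k + 1))) := fun k hk => ih k hk (by omega)
      have V := hV r hr z fun k hk => hz.memPC.weightedBounded hpt (by omega)
      refine V.eqOn_of_solution (x₀ := startValue p t ψ z₀ z r) (hz.memPC.weightedBounded hpt hr)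
        (hy.memPC.weightedBounded hpt hr) (fun τ hτ => ?_) fun τ hτ => ?_
      · rw [← evolution_eq_volterraMap hpt hTS hr hτ]
        exact hz.eq_evolution r hr τ hτ
      · rw [← evolution_eq_volterraMap hpt hTS hr hτ, memoryTerm_congr hpt hr ih',
          startValue_congr hpt hr ih']
        exact hy.eq_evolution r hr τ hτ
  intro τ hτ
  obtain ⟨r, hr, h1 | ⟨h1, h2⟩⟩ := hpt.exists_mem hτ
  · exact key r hr h1
  · obtain ⟨k, rfl⟩ := Nat.exists_eq_succ_of_ne_zero (by omega : r ≠ 0)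
    rw [hz.eq_impulse _ h1 hr τ h2, hy.eq_impulse _ h1 hr τ h2,
      key k (by omega) ⟨hpt.p_lt_t k (by omega), le_rfl⟩]

end Stages

end RLImpulse

theorem theorem1
    {Z U : Type*} [NormedAddCommGroup Z] [NormedSpace ℝ Z] [CompleteSpace Z]
    [NormedAddCommGroup U] [NormedSpace ℝ U] [CompleteSpace U]
    (η q a : ℝ) (hη0 : 0 < η) (hη1 : η < 1)
    -- (H0)
    (hq : q ∈ Ioo (1 / η) (1 / (1 - η)))
    -- the impulse times
    (m : ℕ) (p t : ℕ → ℝ) (hpt : RLImpulse.IsImpulseTimes m a p t)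
    -- the semigroup and its densely defined generator
    (A : Z →ₗ.[ℝ] Z) (hA : Dense (A.domain : Set Z))
    (T : ℝ → Z →L[ℝ] Z) (hT : RLImpulse.IsC0Semigroup T) (hAT : RLImpulse.IsGenerator A T)
    -- the control operator
    (B : Lp U (ENNReal.ofReal q) (volume.restrict (Icc 0 a)) →ₗ[ℝ]
      Lp Z (ENNReal.ofReal q) (volume.restrict (Icc 0 a)))
    (z₀ : Z) (h : ℝ → Z → Z)
    (hmeas : ∀ x : Z, AEStronglyMeasurable (fun s => h s x) (volume.restrict (Icc 0 a)))
    -- (H1)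
    (κ : ℝ) (hκ : 0 < κ)
    (H1 : ∀ s ∈ Icc 0 a, ∀ x y : Z, ‖h s x - h s y‖ ≤ κ * ‖x - y‖)
    -- (H2)
    (H2 : ∃ (ς : ℝ → ℝ) (d : ℝ), MemLp ς (ENNReal.ofReal q) (volume.restrict (Icc 0 a)) ∧
      (∀ s ∈ Icc 0 a, 0 ≤ ς s) ∧ 0 < d ∧
      ∀ r, r ≤ m → ∀ᵐ s ∂(volume.restrict (Ioc (p r) (p (r + 1)))), ∀ x : Z,
        ‖h s x‖ ≤ ς s + d * (s - p r) ^ (1 - η) * ‖x‖)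
    -- (H3)
    (ψ : ℕ → ℝ → Z → Z) (b : ℕ → ℝ)
    (H3_cont : ∀ r, 1 ≤ r → r ≤ m →
      ContinuousOn (fun x : ℝ × Z => ψ r x.1 x.2) (Icc (t r) (p r) ×ˢ univ))
    (H3_b : ∀ r, 1 ≤ r → r ≤ m → b r ∈ Ioc (0 : ℝ) 1)
    (H3_lip : ∀ r, 1 ≤ r → r ≤ m → ∀ s ∈ Icc (t r) (p r), ∀ x y : Z,
      ‖ψ r s x - ψ r s y‖ ≤ b r * ‖x - y‖)
    -- (H4)
    (H4 : RLImpulse.nu η (RLImpulse.semigroupBound T a) κ m p t b < 1)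
    (u : Lp U (ENNReal.ofReal q) (volume.restrict (Icc 0 a))) :
    ∃ z : ℝ → Z, RLImpulse.IsMildSolution η m p t T (B u) h ψ z₀ z ∧
      ∀ y : ℝ → Z, RLImpulse.IsMildSolution η m p t T (B u) h ψ z₀ y →
        EqOn y z (Ioc 0 a) := by 
  obtain ⟨ς, d, hς, -, -, hh⟩ := H2
  have ha : 0 ≤ a := by
    rw [← hpt.p_last]; exact hpt.p_nonneg le_rfl
  obtain ⟨S, K, -, hSK, hS, hTS⟩ := RLImpulse.exists_fracOp_eq_clm hη0 hη1 hT ha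
  -- the nonlinearity contributes the singularity `1 - η`, the memory term the singularity `η`
  have hV : ∀ r, r ≤ m → ∀ z : ℝ → Z,
      (∀ k, k < r → RLImpulse.WeightedBounded η (p k) (t (k + 1)) z) →
      RLImpulse.VolterraData η q (max η (1 - η)) (p r) (t (r + 1)) K κ S
        (fun s => B u s + RLImpulse.memoryTerm η p t ψ z r s) h := by
    intro r hr z hz
    have hsub := hpt.Ioc_subset hr
    have hmono := Measure.restrict_mono hsub (le_refl (volume : Measure ℝ))
    have hmeas' : ∀ x : Z, AEStronglyMeasurable (fun s => h s x)
        (volume.restrict (Ioc (p r) (t (r + 1)))) := fun x => (hmeas x).mono_measure hmono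
    refine ⟨hη0, hη1, hq.1, le_max_right _ _, max_lt hη1 (by linarith), hpt.p_lt_t r hr, hS, hSK,
      ?_, hmeas', hκ.le, fun s hs => H1 s (hsub hs), ⟨hmeas' 0, ς, 0, hς.mono_measure hmono,
        le_rfl, ?_⟩⟩
    · exact (RLImpulse.SingularLp.of_memLp ((Lp.memLp (B u)).mono_measure hmono)).add
        (RLImpulse.singularLp_memoryTerm hpt hη0 (le_max_left _ _) H3_cont hr hz)
    · filter_upwards [ae_restrict_of_ae_restrict_of_subset
        (Ioc_subset_Ioc_right (hpt.t_le_p hr)) (hh r hr)] with s hs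
      have := hs 0
      rw [norm_zero, mul_zero, add_zero] at this
      rw [zero_mul, add_zero]
      exact this.trans (le_abs_self _)
  obtain ⟨z, hz⟩ := RLImpulse.exists_isMildSolution (z₀ := z₀) hpt hη1 hTS H3_cont hV
  exact ⟨z, hz, fun y hy => hy.eqOn hpt hTS hV hz⟩
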